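/- Fix $d\ge 1$, $B>0$, $\lambda>0$, $n\ge 2$, and an arbitrary (deterministic) sequence $(x_1,y_1),\dots,(x_n,y_n)\in[0,1]^d\times[-B,B]$; the loss is $\ell(\hat y,y)=(\hat y-y)^2$. **Mondrian process.** Let $\Pi\sim\mathsf{MP}$ be an infinite Mondrian partition of $[0,1]^d$: each node $\mathbf v\in\{0,1\}^*$ has a birth time $\tau_{\mathbf v}$ and a cell $C_{\mathbf v}$, a box with side lengths $|C^1_{\mathbf v}|,\dots,|C^d_{\mathbf v}|$ and linear dimension $|C_{\mathbf v}|=\sum_j|C_{\mathbf v}^j|$. The root has cell $[0,1]^d$ and birth time $0$. Recursively, and with independent randomness at different nodes, $\mathbf v$ draws $E\sim\mathsf{Exp}(|C_{\mathbf v}|)$ and, independently, a split dimension $j$ with probability $|C^j_{\mathbf v}|/|C_{\mathbf v}|$ and then a threshold $s$ uniform on the $j$-th side of $C_{\mathbf v}$. Its children have birth time $\tau_{\mathbf v0}=\tau_{\mathbf v1}=\tau_{\mathbf v}+E$ and cells $C_{\mathbf v0}=\{x\in C_{\mathbf v}:x_j\le s\}$, $C_{\mathbf v1}=C_{\mathbf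 v}\setminus C_{\mathbf v0}$. The time pruning $\Pi_\lambda$ is obtained from $\Pi$ by removing every node $\mathbf v$ with $\tau_{\mathbf v}>\lambda$; its law is denoted $\mathsf{MP}(\lambda)$, and its cells are the cells of its leaves. **AMF.** Let $\hat y_{\mathbf v,t}$ be the mean of the $y_s$ with $s\le t-1$ and $x_s\in C_{\mathbf v}$ (and $0$ if there are none). For a finite subtree $T$ of $\{0,1\}^*$ (containing the root, every node having $0$ or $2$ children in $T$) let $\hat y_{T,t}(x)=\hat y_{\mathbf v,t}$, where $\mathbf v$ is the leaf of $T$ whose cell contains $x$, and let $L_t(T)=\sum_{s=1}^{t}\ell(\hat y_{T,s}(x_s),y_s)$. With $|T|$ the number of nodes of $T$ and $\eta=1/(8B^2)$, the AMF prediction function at step $t$ is $$\hat f_t(x)=\frac{\sum_T 2^{-|T|}e^{-\eta L_{t-1}(T)}\,\hat y_{T,t}(x)}{\sum_T 2^{-|T|}e^{-\eta L_{t-1}(T)}},$$ the sums being over all such finite subtrees $T$. **Claim.** Both random variables below are integrable, and $$\mathbb E\Big[\sum_{t=1}^n\ell(\hat f_t(x_t),y_t)\Big]\le\mathbb E\Big[\inf_g\sum_{t=1}^n\ell(g(x_t),y_t)\Big]+8B^2(1+\lambda)^d\log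 n,$$ where the expectations are over the random sampling of $\Pi$ (hence of $\Pi_\lambda\sim\mathsf{MP}(\lambda)$), and the infimum is over all functions $g:[0,1]^d\to\mathbb R$ that are constant on the cells of $\Pi_\lambda$. -/

import Mathlib

open MeasureTheory ProbabilityTheory

noncomputable section

/-! ### Words, boxes, and labelled infinite binary trees -/

/-- Nodes of the complete binary tree: finite words on `{0, 1}` (`false` is `0`, `true` is `1`).
A word is stored with its last letter first, so the root is `[]` and the children of `v` are
`false :: v` (left) and `true :: v` (right). -/
abbrev Word := List Bool

/-- The feature space `[0,1]^d`. -/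
abbrev Cube (d : ℕ) := Fin d → unitInterval

/-- A hyper-rectangular box `∏_j [a_j, b_j]`, stored as the family of pairs `(a_j, b_j)`. -/
abbrev Box (d : ℕ) := Fin d → ℝ × ℝ

/-- The side length `|C^j| = b_j - a_j`. -/
def Box.side {d : ℕ} (C : Box d) (j : Fin d) : ℝ := (C j).2 - (C j).1

/-- The linear dimension `|C| = ∑_j |C^j|`. -/
def Box.linDim {d : ℕ} (C : Box d) : ℝ := ∑ j, C.side j

/-- The child boxes of `C` under the split at coordinate `j` and threshold `s`:
the left child (`b = false`) is the part below `s`, the right child the part above `s`. -/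
def Box.child {d : ℕ} (C : Box d) (j : Fin d) (s : ℝ) (b : Bool) : Box d := fun i =>
  if i = j then (if b then (s, (C i).2) else ((C i).1, s)) else C i

/-- A realization of an infinite tree partition with split times: every node `v` of the complete
binary tree carries its split dimension `j_v`, its threshold `s_v`, and the time at which it is
split (the common birth time of its two children). -/
abbrev InfTree (d : ℕ) := Word → Fin d × ℝ × ℝ

/-- Birth time of a node: `0` for the root, and the split time of the parent otherwise. -/
def birth {d : ℕ} (P : InfTree d) : Word → ℝ
  | [] => 0
  | _ :: v => (P v).2.2

/-- Whether `z` goes to the right child at node `v`, i.e. `z_{j_v} > s_v`. -/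
def goesRight {d : ℕ} (P : InfTree d) (v : Word) (z : Cube d) : Prop :=
  (P v).2.1 < (z (P v).1 : ℝ)

/-- The cell `C_v`: the whole cube at the root, `C_{v0} = {z ∈ C_v : z_{j_v} ≤ s_v}`, and
`C_{v1} = C_v \ C_{v0}`. -/
def cell {d : ℕ} (P : InfTree d) : Word → Set (Cube d)
  | [] => Set.univ
  | false :: v => {z ∈ cell P v | ¬ goesRight P v z}
  | true :: v => {z ∈ cell P v | goesRight P v z}

/-! ### The Mondrian process -/

/-- The independent randomness used at one node: an `Exp(1)` variable and two uniform variables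
on `[0, 1]`, one for the split dimension and one for the threshold. -/
abbrev Seed := ℝ × unitInterval × unitInterval

/-- The law of the randomness at one node. -/
def seedLaw : Measure Seed := (expMeasure 1).prod volume

instance instIsProbabilityMeasureSeedLaw : IsProbabilityMeasure seedLaw := by
  have : IsProbabilityMeasure (expMeasure 1) := isProbabilityMeasure_expMeasure one_pos
  unfold seedLaw
  infer_instance

open Classical in
/-- The split dimension drawn from a uniform `u`, by inversion of the distribution function: the
first `j` with `u |C| < |C^1| + ... + |C^j|`. So `j` has probability `|C^j| / |C|`. (If there is
no such `j`, which has probability zero, it is an arbitrary coordinate.) -/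
def splitDim {d : ℕ} [NeZero d] (C : Box d) (u : ℝ) : Fin d :=
  if h : (Finset.univ.filter fun k : Fin d =>
      u * C.linDim < ∑ i ∈ Finset.Iic k, C.side i).Nonempty
  then Finset.min' _ h
  else 0

/-- One step of the sampling of a Mondrian, at a node with cell `C` and birth time `τ`:
the split dimension `j`, with probabilities `|C^j| / |C|`, the threshold, uniform on `C^j`, and the
split time `τ + E` with `E ∼ Exp(|C|)`. -/
def nodeStep {d : ℕ} [NeZero d] (C : Box d) (τ : ℝ) (ω : Seed) : Fin d × ℝ × ℝ :=
  let j := splitDim C (ω.2.1 : ℝ)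
  (j, (C j).1 + (ω.2.2 : ℝ) * C.side j, τ + ω.1 / C.linDim)

/-- The box and birth time of every node, produced by recursive sampling from the root
`([0,1]^d, 0)`, where node `v` uses its own seed `ω v`. -/
def sampleState (d : ℕ) [NeZero d] (ω : Word → Seed) : Word → Box d × ℝ
  | [] => (fun _ => (0, 1), 0)
  | b :: v =>
    let C := (sampleState d ω v).1
    let r := nodeStep C (sampleState d ω v).2 (ω v)
    (C.child r.1 r.2.1 b, r.2.2)

/-- The infinite Mondrian sampled from the family of seeds `ω`. -/
def sampleMondrian {d : ℕ} [NeZero d] (ω : Word → Seed) : InfTree d := fun v =>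
  nodeStep (sampleState d ω v).1 (sampleState d ω v).2 (ω v)

/-- The infinite Mondrian process `MP` on `[0,1]^d`: the law of the output of the sampling
procedure, run with independent randomness at the nodes. -/
def mondrianProcess (d : ℕ) [NeZero d] : Measure (InfTree d) :=
  (Measure.infinitePi fun _ : Word => seedLaw).map sampleMondrian

/-! The sampling map is measurable, so that `mondrianProcess d` is a probability measure. -/

theorem measurable_side {d : ℕ} (j : Fin d) : Measurable fun C : Box d => C.side j := by
  unfold Box.side
  fun_prop

theorem measurable_linDim {d : ℕ} : Measurable fun C : Box d => C.linDim := by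
  unfold Box.linDim
  exact Finset.measurable_sum _ fun j _ => measurable_side j

theorem splitDim_eq_iff {d : ℕ} [NeZero d] (C : Box d) (u : ℝ) (j : Fin d) :
    splitDim C u = j ↔
      (u * C.linDim < ∑ i ∈ Finset.Iic j, C.side i ∧
        ∀ k < j, ¬ u * C.linDim < ∑ i ∈ Finset.Iic k, C.side i) ∨
      (j = 0 ∧ ∀ k : Fin d, ¬ u * C.linDim < ∑ i ∈ Finset.Iic k, C.side i) := by
  classical
  unfold splitDim
  split_ifs with h
  · rw [Finset.min'_eq_iff]
    have h2 : ¬ ∀ k : Fin d, ¬ u * C.linDim < ∑ i ∈ Finset.Iic k, C.side i := by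
      obtain ⟨k, hk⟩ := h
      intro hh
      exact hh k (Finset.mem_filter.1 hk).2
    simp only [Finset.mem_filter, Finset.mem_univ, true_and, h2, and_false, or_false]
    refine and_congr_right fun _ => ⟨fun hh k hk hlt => ?_, fun hh k hk => ?_⟩
    · exact absurd (hh k hlt) (not_le.2 hk)
    · by_contra hlt
      exact hh k (not_le.1 hlt) hk
  · have h2 : ∀ k : Fin d, ¬ u * C.linDim < ∑ i ∈ Finset.Iic k, C.side i := by
      intro k hk
      exact h ⟨k, by simpa using hk⟩
    constructor
    · intro hj
      exact Or.inr ⟨hj.symm, h2⟩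
    · rintro (hj | hj)
      · exact absurd hj.1 (h2 j)
      · exact hj.1.symm

theorem measurable_splitDim {d : ℕ} [NeZero d] :
    Measurable fun p : Box d × ℝ => splitDim p.1 p.2 := by
  refine measurable_to_countable' fun j => ?_
  have hm : ∀ k : Fin d, MeasurableSet {p : Box d × ℝ |
      p.2 * p.1.linDim < ∑ i ∈ Finset.Iic k, p.1.side i} := fun k =>
    measurableSet_lt (measurable_snd.mul (measurable_linDim.comp measurable_fst))
      (Finset.measurable_sum _ fun i _ => (measurable_side i).comp measurable_fst)
  have hset : (fun p : Box d × ℝ => splitDim p.1 p.2) ⁻¹' {j} = {p |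
      (p.2 * p.1.linDim < ∑ i ∈ Finset.Iic j, p.1.side i ∧
        ∀ k < j, ¬ p.2 * p.1.linDim < ∑ i ∈ Finset.Iic k, p.1.side i) ∨
      (j = 0 ∧ ∀ k : Fin d, ¬ p.2 * p.1.linDim < ∑ i ∈ Finset.Iic k, p.1.side i)} := by
    ext p
    exact splitDim_eq_iff p.1 p.2 j
  rw [hset]
  have h1 : MeasurableSet {p : Box d × ℝ |
      ∀ k < j, ¬ p.2 * p.1.linDim < ∑ i ∈ Finset.Iic k, p.1.side i} := by
    simp only [Set.ofPred_forall]
    exact MeasurableSet.iInter fun k => MeasurableSet.iInter fun _ => (hm k).compl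
  have h2 : MeasurableSet {p : Box d × ℝ |
      ∀ k : Fin d, ¬ p.2 * p.1.linDim < ∑ i ∈ Finset.Iic k, p.1.side i} := by
    simp only [Set.ofPred_forall]
    exact MeasurableSet.iInter fun k => (hm k).compl
  exact ((hm j).inter h1).union ((MeasurableSet.const _).inter h2)

theorem measurable_coord_apply {d : ℕ} {α β : Type*} [MeasurableSpace α] [MeasurableSpace β]
    {f : α → Fin d → β} {g : α → Fin d} (hf : Measurable f) (hg : Measurable g) :
    Measurable fun a => f a (g a) := by
  have h : Measurable fun p : (Fin d → β) × Fin d => p.1 p.2 :=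
    measurable_from_prod_countable_left fun j => measurable_pi_apply j
  exact h.comp (hf.prodMk hg)

theorem measurable_splitDim_comp {d : ℕ} [NeZero d] {α : Type*} [MeasurableSpace α]
    {C : α → Box d} {u : α → ℝ} (hC : Measurable C) (hu : Measurable u) :
    Measurable fun a => splitDim (C a) (u a) :=
  measurable_splitDim.comp (hC.prodMk hu)

theorem measurable_threshold {d : ℕ} {α : Type*} [MeasurableSpace α]
    {C : α → Box d} {j : α → Fin d} {u : α → ℝ} (hC : Measurable C) (hj : Measurable j)
    (hu : Measurable u) : Measurable fun a => (C a (j a)).1 + u a * (C a).side (j a) := by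
  have hCj : Measurable fun a => C a (j a) := measurable_coord_apply hC hj
  unfold Box.side
  exact hCj.fst.add (hu.mul (hCj.snd.sub hCj.fst))

theorem measurable_nodeStep {d : ℕ} [NeZero d] {α : Type*} [MeasurableSpace α]
    {C : α → Box d} {τ : α → ℝ} {ω : α → Seed} (hC : Measurable C) (hτ : Measurable τ)
    (hω : Measurable ω) : Measurable fun a => nodeStep (C a) (τ a) (ω a) := by
  have hu : Measurable fun a => ((ω a).2.1 : ℝ) := measurable_subtype_coe.comp hω.snd.fst
  have hV : Measurable fun a => ((ω a).2.2 : ℝ) := measurable_subtype_coe.comp hω.snd.snd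
  have hj := measurable_splitDim_comp hC hu
  have h2 : Measurable fun a => τ a + (ω a).1 / (C a).linDim :=
    hτ.add (hω.fst.div (measurable_linDim.comp hC))
  exact hj.prodMk ((measurable_threshold hC hj hV).prodMk h2)

theorem measurable_child {d : ℕ} {α : Type*} [MeasurableSpace α] {C : α → Box d}
    {j : α → Fin d} {s : α → ℝ} (hC : Measurable C) (hj : Measurable j) (hs : Measurable s)
    (b : Bool) : Measurable fun a => (C a).child (j a) (s a) b := by
  refine measurable_pi_lambda _ fun i => ?_
  have hi : Measurable fun a => C a i := (measurable_pi_apply i).comp hC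
  have hset : MeasurableSet {a | i = j a} := measurableSet_eq_fun measurable_const hj
  unfold Box.child
  refine Measurable.ite hset ?_ hi
  cases b
  · exact hi.fst.prodMk hs
  · exact hs.prodMk hi.snd

theorem measurable_sampleState {d : ℕ} [NeZero d] (v : Word) :
    Measurable fun ω : Word → Seed => sampleState d ω v := by
  induction v with
  | nil =>
    simp only [sampleState]
    exact measurable_const
  | cons b v ih =>
    have hr := measurable_nodeStep ih.fst ih.snd (measurable_pi_apply v)
    simp only [sampleState]
    exact (measurable_child ih.fst hr.fst hr.snd.fst b).prodMk hr.snd.snd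

theorem measurable_sampleMondrian {d : ℕ} [NeZero d] :
    Measurable (sampleMondrian (d := d)) :=
  measurable_pi_lambda _ fun v =>
    measurable_nodeStep (measurable_sampleState v).fst (measurable_sampleState v).snd
      (measurable_pi_apply v)

instance instIsProbabilityMeasureMondrianProcess (d : ℕ) [NeZero d] :
    IsProbabilityMeasure (mondrianProcess d) :=
  Measure.isProbabilityMeasure_map measurable_sampleMondrian.aemeasurable

/-! ### Time prunings -/

/-- The node set of the time pruning `Π_lam`: nodes with birth time larger than `lam` are
removed. -/
def timePruning {d : ℕ} (P : InfTree d) (lam : ℝ) : Set Word := {v | birth P v ≤ lam}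

/-- The leaves of a tree given by its set of nodes. -/
def leaves (T : Set Word) : Set Word := {v ∈ T | false :: v ∉ T ∧ true :: v ∉ T}

/-- `g` is constant on each of the cells of the time pruning `Π_lam`, i.e. on `C_v` for each
leaf `v`. -/
def ConstOnCells {d : ℕ} (P : InfTree d) (lam : ℝ) (g : Cube d → ℝ) : Prop :=
  ∀ v ∈ leaves (timePruning P lam), ∀ z ∈ cell P v, ∀ z' ∈ cell P v, g z = g z'

/-! ### The forecaster AMF for regression -/

/-- Finite subtrees (prunings) of the complete binary tree: each node has zero or two children. -/
inductive Pruning : Type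
  | leaf : Pruning
  | node : Pruning → Pruning → Pruning

/-- The number `|T|` of nodes, interior nodes and leaves together. -/
def Pruning.size : Pruning → ℕ
  | .leaf => 1
  | .node l r => 1 + l.size + r.size

open Classical in
/-- The leaf whose cell contains `z`, for a pruning that hangs below the node `v`. -/
def Pruning.leafFrom {d : ℕ} (P : InfTree d) (z : Cube d) : Pruning → Word → Word
  | .leaf, v => v
  | .node l r, v =>
    if goesRight P v z then r.leafFrom P z (true :: v) else l.leafFrom P z (false :: v)

/-- The leaf of the pruning `T` (with root the root of the infinite tree) that contains `z`. -/
def Pruning.leafOf {d : ℕ} (T : Pruning) (P : InfTree d) (z : Cube d) : Word :=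
  T.leafFrom P z []

section Forecaster

open Classical in
/-- Prediction of the node `v` before round `t`: the mean of the labels `y_s`, `s < t`, with
`x_s` in the cell of `v`, and `0` if there are none (Lean has `0 / 0 = 0`). -/
def nodePred {d : ℕ} (P : InfTree d) (x : ℕ → Cube d) (y : ℕ → ℝ) (v : Word) (t : ℕ) : ℝ :=
  (∑ s ∈ (Finset.range t).filter (fun s => x s ∈ cell P v), y s) /
    ((Finset.range t).filter (fun s => x s ∈ cell P v)).card

/-- Prediction at `z` of the pruning `T` before round `t`. -/
def treePred {d : ℕ} (P : InfTree d) (x : ℕ → Cube d) (y : ℕ → ℝ) (T : Pruning) (t : ℕ)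
    (z : Cube d) : ℝ :=
  nodePred P x y (T.leafOf P z) t

/-- Cumulative square loss of the pruning `T` over the rounds `s < t`. -/
def cumLoss {d : ℕ} (P : InfTree d) (x : ℕ → Cube d) (y : ℕ → ℝ) (T : Pruning) (t : ℕ) : ℝ :=
  ∑ s ∈ Finset.range t, (treePred P x y T s (x s) - y s) ^ 2

/-- The unnormalized weight `π(T) exp(-η L(T))` of a pruning before round `t`, with the prior
`π(T) = 2^{-|T|}`. -/
def aggWeight {d : ℕ} (η : ℝ) (P : InfTree d) (x : ℕ → Cube d) (y : ℕ → ℝ) (t : ℕ)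
    (T : Pruning) : ℝ :=
  (1 / 2) ^ T.size * Real.exp (-η * cumLoss P x y T t)

/-- The AMF prediction function before round `t`, with learning rate `η`: the exponentially
weighted aggregation of all finite prunings of the infinite tree. -/
def amf {d : ℕ} (η : ℝ) (P : InfTree d) (x : ℕ → Cube d) (y : ℕ → ℝ) (t : ℕ)
    (z : Cube d) : ℝ :=
  (∑' T : Pruning, aggWeight η P x y t T * treePred P x y T t z) /
    ∑' T : Pruning, aggWeight η P x y t T

end Forecaster

end

/-! Fix a tree whose time pruning is finite, and let `T` be that pruning, with `K` leaves and hence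
`2K - 1` nodes. For predictions and labels in `[-B, B]`, `exp (-η (p - y)²)` is concave in `p` when
`η = 1/(8B²)`. The total weight therefore shrinks in each round at least as fast as the forecaster's
own loss dictates. As the prior has mass at most `1`, competing with `T` costs at most `8B² log 2 *
|T|` (`sum_amf_loss_le`). Within a leaf, the running mean loses at most `B² (4 H_n - 3)` against the
final mean (`cumLoss_le`), and the final leaf means attain the infimum over `g`
(`Pruning.Fits.iInf_eq`). For large `n` the two costs add up to at most `8B² K log n`; for small `n`
a crude bound on the forecaster's loss replaces them (`Pruning.Fits.regret_le`).

It remains to bound the mean of `K` by `(1 + lam)^d`. Put `G s = ∏ j, (1 + |C^j| s)`. Splitting side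
`j` of `C` raises the sum of the children's products above `G` by the product over the other sides,
wherever the threshold falls; averaged over `j`, the excess is `G' / |C|`. With an exponential
waiting time of rate `|C|`, the renewal integral then has an explicit antiderivative and returns `G`
(`lintegral_exp_renewal_le`, `lintegral_nodeStep_le`).

A time pruning is not known in advance to be finite, so the induction runs on leaf counts cut at
depth `k`. Monotone convergence removes the cut, and the finite mean also shows that almost every
time pruning is finite (`ae_exists_fits`). -/

noncomputable section

/-! ### Prunings -/

/-- The number of leaves of a pruning. -/
def Pruning.leafCount : Pruning → ℕ
  | .leaf => 1
  | .node l r => l.leafCount + r.leafCount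

theorem Pruning.size_add_one (T : Pruning) : T.size + 1 = 2 * T.leafCount := by
  induction T with
  | leaf => rfl
  | node l r hl hr => simp only [Pruning.size, Pruning.leafCount]; omega

theorem Pruning.one_le_leafCount (T : Pruning) : 1 ≤ T.leafCount := by
  induction T with
  | leaf => exact le_rfl
  | node l r hl hr => simp only [Pruning.leafCount]; omega

open Classical in
/-- The prunings of depth at most `k`. -/
def Pruning.ofDepthLE : ℕ → Finset Pruning
  | 0 => {.leaf}
  | k + 1 => insert .leaf
      ((ofDepthLE k ×ˢ ofDepthLE k).image fun p => Pruning.node p.1 p.2)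

theorem Pruning.mem_ofDepthLE {T : Pruning} {k : ℕ} (h : T.size ≤ k) :
    T ∈ Pruning.ofDepthLE k := by
  induction T generalizing k with
  | leaf => cases k <;> simp [Pruning.ofDepthLE]
  | node l r hl hr =>
    simp only [Pruning.size] at h
    obtain ⟨k, rfl⟩ : ∃ m, k = m + 1 := ⟨k - 1, by omega⟩
    simp only [Pruning.ofDepthLE, Finset.mem_insert, Finset.mem_image, Finset.mem_product]
    exact Or.inr ⟨(l, r), ⟨hl (by omega), hr (by omega)⟩, rfl⟩

/-- The mass `S k` obeys `S (k + 1) = 1/2 + S k ^ 2 / 2`, and this map preserves `[0, 1]`. -/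
theorem Pruning.sum_ofDepthLE (k : ℕ) :
    ∑ T ∈ Pruning.ofDepthLE k, (1 / 2 : ℝ) ^ T.size ≤ 1 := by
  classical
  induction k with
  | zero => norm_num [Pruning.ofDepthLE, Pruning.size]
  | succ k ih =>
    have h0 : (0 : ℝ) ≤ ∑ T ∈ Pruning.ofDepthLE k, (1 / 2 : ℝ) ^ T.size :=
      Finset.sum_nonneg fun _ _ => by positivity
    have himg : ∑ T ∈ (Pruning.ofDepthLE k ×ˢ Pruning.ofDepthLE k).image
          (fun p => Pruning.node p.1 p.2), (1 / 2 : ℝ) ^ T.size =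
        1 / 2 * (∑ T ∈ Pruning.ofDepthLE k, (1 / 2 : ℝ) ^ T.size) ^ 2 := by
      rw [Finset.sum_image, Finset.sum_product, sq, Finset.sum_mul_sum, Finset.mul_sum]
      · refine Finset.sum_congr rfl fun l _ => ?_
        rw [Finset.mul_sum]
        refine Finset.sum_congr rfl fun r _ => ?_
        simp only [Pruning.size, pow_add, pow_one, mul_assoc]
      · rintro ⟨l, r⟩ _ ⟨l', r'⟩ _ h
        simpa using h
    simp only [Pruning.ofDepthLE]
    rw [Finset.sum_insert (by simp), himg]
    simp only [Pruning.size]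
    nlinarith

theorem Pruning.sum_prior_le (s : Finset Pruning) : ∑ T ∈ s, (1 / 2 : ℝ) ^ T.size ≤ 1 := by
  refine le_trans (Finset.sum_le_sum_of_subset_of_nonneg (t := Pruning.ofDepthLE (s.sup size))
    (fun T hT => Pruning.mem_ofDepthLE (Finset.le_sup hT)) fun _ _ _ => by positivity)
    (Pruning.sum_ofDepthLE _)

theorem Pruning.summable_prior : Summable fun T : Pruning => (1 / 2 : ℝ) ^ T.size :=
  summable_of_sum_le (fun _ => by positivity) Pruning.sum_prior_le

theorem Pruning.tsum_prior_le : ∑' T : Pruning, (1 / 2 : ℝ) ^ T.size ≤ 1 :=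
  Pruning.summable_prior.tsum_le_of_sum_le Pruning.sum_prior_le

instance Pruning.instCountable : Countable Pruning := by
  rw [← Set.countable_univ_iff]
  refine (Set.countable_iUnion fun k => (Pruning.ofDepthLE k).countable_toSet).mono fun T _ => ?_
  exact Set.mem_iUnion.2 ⟨T.size, Pruning.mem_ofDepthLE le_rfl⟩

/-! ### Ranges of the predictions -/

section Forecast

variable {d : ℕ} {P : InfTree d} {x : ℕ → Cube d} {y : ℕ → ℝ}

/-- The interval must contain `0` because an unvisited node predicts `0`. Asymmetric and degenerate
intervals are used later for the first two rounds. -/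
theorem nodePred_mem_Icc {a b : ℝ} (ha : a ≤ 0) (hb : 0 ≤ b) {t : ℕ}
    (hy : ∀ s < t, y s ∈ Set.Icc a b) (v : Word) : nodePred P x y v t ∈ Set.Icc a b := by
  classical
  unfold nodePred
  set S := (Finset.range t).filter fun s => x s ∈ cell P v with hS
  have hyS : ∀ s ∈ S, y s ∈ Set.Icc a b := fun s hs =>
    hy s (Finset.mem_range.1 (Finset.mem_filter.1 hs).1)
  rcases Nat.eq_zero_or_pos S.card with h0 | hpos
  · simp [h0, ha, hb]
  · have hc : (0 : ℝ) < S.card := by exact_mod_cast hpos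
    constructor
    · rw [le_div_iff₀ hc, mul_comm, ← nsmul_eq_mul]
      exact Finset.card_nsmul_le_sum _ _ _ fun s hs => (hyS s hs).1
    · rw [div_le_iff₀ hc, mul_comm, ← nsmul_eq_mul]
      exact Finset.sum_le_card_nsmul _ _ _ fun s hs => (hyS s hs).2

theorem cumLoss_nonneg (T : Pruning) (t : ℕ) : 0 ≤ cumLoss P x y T t :=
  Finset.sum_nonneg fun _ _ => sq_nonneg _

theorem aggWeight_pos (η : ℝ) (t : ℕ) (T : Pruning) : 0 < aggWeight η P x y t T := by
  unfold aggWeight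
  positivity

theorem aggWeight_le {η : ℝ} (hη : 0 ≤ η) (t : ℕ) (T : Pruning) :
    aggWeight η P x y t T ≤ (1 / 2) ^ T.size := by
  unfold aggWeight
  refine mul_le_of_le_one_right (by positivity) (Real.exp_le_one_iff.2 ?_)
  have := mul_nonneg hη (cumLoss_nonneg (P := P) (x := x) (y := y) T t)
  linarith

theorem summable_aggWeight {η : ℝ} (hη : 0 ≤ η) (t : ℕ) : Summable (aggWeight η P x y t) :=
  Pruning.summable_prior.of_nonneg_of_le (fun T => (aggWeight_pos η t T).le) (aggWeight_le hη t)

theorem tsum_aggWeight_pos {η : ℝ} (hη : 0 ≤ η) (t : ℕ) : 0 < ∑' T, aggWeight η P x y t T :=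
  (summable_aggWeight hη t).tsum_pos (fun T => (aggWeight_pos η t T).le) .leaf
    (aggWeight_pos η t _)

theorem summable_aggWeight_mul {η : ℝ} (hη : 0 ≤ η) (t : ℕ) {f : Pruning → ℝ} {M : ℝ}
    (hf : ∀ T, |f T| ≤ M) : Summable fun T => aggWeight η P x y t T * f T := by
  refine Summable.of_norm_bounded
    ((summable_aggWeight (P := P) (x := x) (y := y) hη t).mul_right M) fun T => ?_
  rw [norm_mul, Real.norm_of_nonneg (aggWeight_pos η t T).le]
  exact mul_le_mul_of_nonneg_left (hf T) (aggWeight_pos η t T).le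

theorem amf_mem_Icc {η : ℝ} (hη : 0 ≤ η) {a b : ℝ} (ha : a ≤ 0) (hb : 0 ≤ b) {t : ℕ}
    (hy : ∀ s < t, y s ∈ Set.Icc a b) (z : Cube d) : amf η P x y t z ∈ Set.Icc a b := by
  have hp : ∀ T : Pruning, treePred P x y T t z ∈ Set.Icc a b := fun T =>
    nodePred_mem_Icc ha hb hy _
  have hW := tsum_aggWeight_pos (P := P) (x := x) (y := y) hη t
  have hs := summable_aggWeight (P := P) (x := x) (y := y) hη t
  have hsp : Summable fun T => aggWeight η P x y t T * treePred P x y T t z :=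
    summable_aggWeight_mul hη t (M := max |a| |b|) fun T => abs_le_max_abs_abs (hp T).1 (hp T).2
  unfold amf
  constructor
  · rw [le_div_iff₀ hW, mul_comm, ← tsum_mul_right]
    exact (hs.mul_right a).tsum_le_tsum
      (fun T => mul_le_mul_of_nonneg_left (hp T).1 (aggWeight_pos η t T).le) hsp
  · rw [div_le_iff₀ hW, mul_comm, ← tsum_mul_right]
    exact hsp.tsum_le_tsum
      (fun T => mul_le_mul_of_nonneg_left (hp T).2 (aggWeight_pos η t T).le) (hs.mul_right b)

/-! ### Exponential concavity of the square loss -/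

theorem hasDerivAt_exp_neg_mul_sq (η z : ℝ) :
    HasDerivAt (fun z : ℝ => Real.exp (-η * z ^ 2)) (-2 * η * z * Real.exp (-η * z ^ 2)) z := by
  have h := ((hasDerivAt_pow 2 z).const_mul (-η)).exp
  convert h using 1
  push_cast
  ring

/-- The second derivative is `-2η (1 - 2ηz²) exp (-ηz²)`, which is nonpositive on `[-M, M]`. The
function is thus concave there and lies below its tangent at `a`; the mean value theorem is applied
on either side of `a`. -/
theorem exp_neg_mul_sq_le_tangent {η M a z : ℝ} (hη : 0 ≤ η) (hM : 2 * η * M ^ 2 ≤ 1)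
    (ha : |a| ≤ M) (hz : |z| ≤ M) :
    Real.exp (-η * z ^ 2) ≤ Real.exp (-η * a ^ 2) * (1 - 2 * η * a * (z - a)) := by
  have hanti : AntitoneOn (fun z : ℝ => -2 * η * z * Real.exp (-η * z ^ 2)) (Set.Icc (-M) M) := by
    have hd : ∀ w : ℝ, HasDerivAt (fun z : ℝ => -2 * η * z * Real.exp (-η * z ^ 2))
        ((-2 * η) * (1 - 2 * η * w ^ 2) * Real.exp (-η * w ^ 2)) w := fun w => by
      have h := ((hasDerivAt_id w).const_mul (-2 * η)).mul (hasDerivAt_exp_neg_mul_sq η w)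
      refine h.congr_deriv ?_
      simp only [id]
      ring
    refine antitoneOn_of_deriv_nonpos (convex_Icc _ _)
      (fun w _ => (hd w).continuousAt.continuousWithinAt)
      (fun w _ => (hd w).differentiableAt.differentiableWithinAt) fun w hw => ?_
    rw [(hd w).deriv]
    rw [interior_Icc] at hw
    have h1 : w ^ 2 ≤ M ^ 2 := sq_le_sq' hw.1.le hw.2.le
    have h2 : 0 ≤ 1 - 2 * η * w ^ 2 := by nlinarith
    have := mul_nonneg (mul_nonneg hη h2) (Real.exp_pos (-η * w ^ 2)).le
    nlinarith
  have haI : a ∈ Set.Icc (-M) M := abs_le.1 ha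
  have hzI : z ∈ Set.Icc (-M) M := abs_le.1 hz
  have hcont : Continuous fun z : ℝ => Real.exp (-η * z ^ 2) := by fun_prop
  rcases lt_trichotomy a z with h | rfl | h
  · obtain ⟨c, hc, hce⟩ := exists_hasDerivAt_eq_slope _ _ h hcont.continuousOn
      fun w _ => hasDerivAt_exp_neg_mul_sq η w
    have := hanti haI ⟨haI.1.trans hc.1.le, hc.2.le.trans hzI.2⟩ hc.1.le
    simp only at this
    rw [hce, div_le_iff₀ (by linarith)] at this
    linarith
  · simp
  · obtain ⟨c, hc, hce⟩ := exists_hasDerivAt_eq_slope _ _ h hcont.continuousOn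
      fun w _ => hasDerivAt_exp_neg_mul_sq η w
    have := hanti ⟨hzI.1.trans hc.1.le, hc.2.le.trans haI.2⟩ haI hc.2.le
    simp only at this
    rw [hce, le_div_iff₀ (by linarith)] at this
    linarith

theorem aggWeight_succ (η : ℝ) (t : ℕ) (T : Pruning) :
    aggWeight η P x y (t + 1) T =
      aggWeight η P x y t T * Real.exp (-η * (treePred P x y T t (x t) - y t) ^ 2) := by
  unfold aggWeight cumLoss
  rw [Finset.sum_range_succ, mul_add, Real.exp_add, mul_assoc]

/-- Jensen's inequality: the tangent bound at the forecaster's residual is averaged over the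
prunings, and the linear term vanishes because the forecast is the weighted mean of the predictions.
-/
theorem tsum_aggWeight_succ_le {B : ℝ} (hB : 0 < B) {t : ℕ}
    (hy : ∀ s ≤ t, y s ∈ Set.Icc (-B) B) :
    ∑' T, aggWeight (1 / (8 * B ^ 2)) P x y (t + 1) T ≤
      (∑' T, aggWeight (1 / (8 * B ^ 2)) P x y t T) *
        Real.exp (-(1 / (8 * B ^ 2)) * (amf (1 / (8 * B ^ 2)) P x y t (x t) - y t) ^ 2) := by
  set η : ℝ := 1 / (8 * B ^ 2) with hηd
  have hη : 0 ≤ η := by positivity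
  -- Residuals have size up to `2B`, and the inequality is an equality: `1/(8B²)` is the largest
  -- admissible rate.
  have hM : 2 * η * (2 * B) ^ 2 ≤ 1 := by
    rw [hηd]; apply le_of_eq; field_simp; ring
  have hylt : ∀ s < t, y s ∈ Set.Icc (-B) B := fun s hs => hy s hs.le
  have hyt := hy t le_rfl
  have hp : ∀ T : Pruning, treePred P x y T t (x t) ∈ Set.Icc (-B) B := fun T =>
    nodePred_mem_Icc (by linarith) hB.le hylt _
  have hA : amf η P x y t (x t) ∈ Set.Icc (-B) B :=
    amf_mem_Icc hη (by linarith) hB.le hylt _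
  have hW := tsum_aggWeight_pos (P := P) (x := x) (y := y) hη t
  have hs := summable_aggWeight (P := P) (x := x) (y := y) hη t
  have hsp : Summable fun T => aggWeight η P x y t T * treePred P x y T t (x t) :=
    summable_aggWeight_mul hη t (M := B) fun T => abs_le.2 (hp T)
  set A := amf η P x y t (x t) with hAd
  have hAW : ∑' T, aggWeight η P x y t T * treePred P x y T t (x t) =
      A * ∑' T, aggWeight η P x y t T := by
    rw [hAd, amf, div_mul_cancel₀ _ hW.ne']
  set e := Real.exp (-η * (A - y t) ^ 2) with he
  have hkey : ∀ T, aggWeight η P x y (t + 1) T ≤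
      aggWeight η P x y t T * (e * (1 + 2 * η * (A - y t) * A)) -
        aggWeight η P x y t T * treePred P x y T t (x t) * (e * (2 * η * (A - y t))) := by
    intro T
    have h := exp_neg_mul_sq_le_tangent (a := A - y t) (z := treePred P x y T t (x t) - y t) hη hM
      (abs_le.2 ⟨by linarith [hA.1, hyt.2], by linarith [hA.2, hyt.1]⟩)
      (abs_le.2 ⟨by linarith [(hp T).1, hyt.2], by linarith [(hp T).2, hyt.1]⟩)
    rw [aggWeight_succ]
    refine (mul_le_mul_of_nonneg_left h (aggWeight_pos η t T).le).trans (le_of_eq ?_)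
    ring
  refine ((summable_aggWeight hη (t + 1)).tsum_le_tsum hkey
    ((hs.mul_right _).sub (hsp.mul_right _))).trans (le_of_eq ?_)
  rw [(hs.mul_right _).tsum_sub (hsp.mul_right _), tsum_mul_right, tsum_mul_right, hAW]
  ring

theorem tsum_aggWeight_le {B : ℝ} (hB : 0 < B) {n : ℕ} (hy : ∀ s < n, y s ∈ Set.Icc (-B) B) :
    ∑' T, aggWeight (1 / (8 * B ^ 2)) P x y n T ≤
      Real.exp (-(1 / (8 * B ^ 2)) *
        ∑ t ∈ Finset.range n, (amf (1 / (8 * B ^ 2)) P x y t (x t) - y t) ^ 2) := by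
  induction n with
  | zero => simpa [aggWeight, cumLoss] using Pruning.tsum_prior_le
  | succ n ih =>
    refine (tsum_aggWeight_succ_le hB fun s hs => hy s (Nat.lt_succ_of_le hs)).trans ?_
    rw [Finset.sum_range_succ, mul_add, Real.exp_add]
    exact mul_le_mul_of_nonneg_right (ih fun s hs => hy s (hs.trans n.lt_succ_self))
      (Real.exp_pos _).le

/-- The regret of the aggregated forecaster against any fixed pruning. -/
theorem sum_amf_loss_le {B : ℝ} (hB : 0 < B) {n : ℕ} (hy : ∀ s < n, y s ∈ Set.Icc (-B) B)
    (T : Pruning) :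
    ∑ t ∈ Finset.range n, (amf (1 / (8 * B ^ 2)) P x y t (x t) - y t) ^ 2 ≤
      cumLoss P x y T n + 8 * B ^ 2 * Real.log 2 * T.size := by
  set η : ℝ := 1 / (8 * B ^ 2) with hηd
  have hη : 0 < η := by positivity
  have hηB : 8 * B ^ 2 * η = 1 := by rw [hηd]; field_simp
  -- The total weight is bounded below by the single weight of `T`, so the prior `2^{-|T|}` costs
  -- `log 2 * |T| / η`.
  have h1 : aggWeight η P x y n T ≤ ∑' T, aggWeight η P x y n T :=
    (summable_aggWeight hη.le n).le_tsum T fun T _ => (aggWeight_pos η n T).le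
  have h2 := h1.trans (tsum_aggWeight_le hB hy)
  have h3 : aggWeight η P x y n T =
      Real.exp (-(Real.log 2 * T.size) + -η * cumLoss P x y T n) := by
    rw [Real.exp_add, Real.exp_neg, mul_comm (Real.log 2), Real.exp_nat_mul,
      Real.exp_log two_pos, aggWeight, one_div, inv_pow]
  rw [h3, Real.exp_le_exp] at h2
  have h4 := mul_le_mul_of_nonneg_left h2 (show (0 : ℝ) ≤ 8 * B ^ 2 by positivity)
  rw [← hηd] at h4
  linear_combination h4 + (cumLoss P x y T n -
    ∑ t ∈ Finset.range n, (amf η P x y t (x t) - y t) ^ 2) * hηB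

end Forecast

/-! ### Regret of the online means against the best constants -/

section Regret

variable {d : ℕ} {P : InfTree d} {x : ℕ → Cube d} {y : ℕ → ℝ}

open Classical in
/-- The rounds `s < n` whose feature falls in the cell of `v`. -/
def visits (P : InfTree d) (x : ℕ → Cube d) (v : Word) (n : ℕ) : Finset ℕ :=
  (Finset.range n).filter fun s => x s ∈ cell P v

theorem mem_visits {v : Word} {n s : ℕ} : s ∈ visits P x v n ↔ s < n ∧ x s ∈ cell P v := by
  simp [visits]

theorem nodePred_eq (v : Word) (n : ℕ) :
    nodePred P x y v n = (∑ s ∈ visits P x v n, y s) / (visits P x v n).card := rfl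

theorem card_visits_le (v : Word) (n : ℕ) : (visits P x v n).card ≤ n := by
  classical
  simpa [visits] using Finset.card_filter_le (Finset.range n) fun s => x s ∈ cell P v

theorem card_visits_mul_nodePred (v : Word) (n : ℕ) :
    ((visits P x v n).card : ℝ) * nodePred P x y v n = ∑ s ∈ visits P x v n, y s := by
  rw [nodePred_eq]
  rcases (visits P x v n).eq_empty_or_nonempty with h | h
  · simp [h]
  · rw [mul_div_cancel₀ _ (by exact_mod_cast h.card_pos.ne')]

theorem sum_sub_sq (S : Finset ℕ) (c : ℝ) :
    ∑ s ∈ S, (c - y s) ^ 2 = S.card * c ^ 2 - 2 * c * ∑ s ∈ S, y s + ∑ s ∈ S, y s ^ 2 := by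
  simp only [sub_sq, Finset.sum_add_distrib, Finset.sum_sub_distrib, ← Finset.mul_sum,
    Finset.sum_const, nsmul_eq_mul]

/-- The two sides differ by `N (mean - c)²`, with `N` the number of visits. -/
theorem sum_nodePred_sub_sq_le (v : Word) (n : ℕ) (c : ℝ) :
    ∑ s ∈ visits P x v n, (nodePred P x y v n - y s) ^ 2 ≤
      ∑ s ∈ visits P x v n, (c - y s) ^ 2 := by
  rw [sum_sub_sq, sum_sub_sq, ← card_visits_mul_nodePred]
  nlinarith [mul_nonneg (Nat.cast_nonneg (α := ℝ) (visits P x v n).card)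
    (sq_nonneg (nodePred P x y v n - c))]

theorem visits_succ_of_mem {v : Word} {n : ℕ} (h : x n ∈ cell P v) :
    visits P x v (n + 1) = insert n (visits P x v n) := by
  ext s
  simp only [mem_visits, Finset.mem_insert]
  constructor
  · rintro ⟨h1, h2⟩
    rcases Nat.lt_succ_iff_lt_or_eq.1 h1 with h1 | h1
    exacts [Or.inr ⟨h1, h2⟩, Or.inl h1]
  · rintro (rfl | ⟨h1, h2⟩)
    exacts [⟨Nat.lt_succ_self _, h⟩, ⟨h1.trans n.lt_succ_self, h2⟩]

theorem visits_succ_of_notMem {v : Word} {n : ℕ} (h : x n ∉ cell P v) :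
    visits P x v (n + 1) = visits P x v n := by
  ext s
  simp only [mem_visits]
  refine ⟨fun ⟨h1, h2⟩ => ⟨?_, h2⟩, fun ⟨h1, h2⟩ => ⟨h1.trans n.lt_succ_self, h2⟩⟩
  rcases Nat.lt_succ_iff_lt_or_eq.1 h1 with h1 | rfl
  exacts [h1, absurd h2 h]

theorem notMem_visits (v : Word) (n : ℕ) : n ∉ visits P x v n := by
  simp [mem_visits]

/-- If the current mean is `m` after `N` visits, a new label `y` raises the least constant loss by
`(m - y)² N / (N + 1)`, so that visit adds `(m - y)² / (N + 1) ≤ 4B² / (N + 1)` to the regret. On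
the first visit the prediction is `0` and the cost is at most `B²` instead of `4B²`, whence the
`-3`. -/
theorem sum_online_le_of_card {B : ℝ} (hB : 0 ≤ B) {n : ℕ}
    (hy : ∀ s < n, y s ∈ Set.Icc (-B) B) (v : Word) :
    ∑ s ∈ visits P x v n, (nodePred P x y v s - y s) ^ 2 ≤
      ∑ s ∈ visits P x v n, (nodePred P x y v n - y s) ^ 2 +
        B ^ 2 * (if (visits P x v n).card = 0 then 0
          else 4 * (harmonic (visits P x v n).card : ℝ) - 3) := by
  induction n with
  | zero => simp [visits]
  | succ n ih =>
    have ih := ih fun s hs => hy s (hs.trans n.lt_succ_self)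
    have hyn := hy n n.lt_succ_self
    by_cases hx : x n ∈ cell P v
    · have hm : nodePred P x y v n ∈ Set.Icc (-B) B :=
        nodePred_mem_Icc (by linarith) hB (fun s hs => hy s (hs.trans n.lt_succ_self)) v
      have hV := visits_succ_of_mem hx
      have hc := card_visits_mul_nodePred (P := P) (x := x) (y := y) v n
      have hc' := card_visits_mul_nodePred (P := P) (x := x) (y := y) v (n + 1)
      have hcard : (visits P x v (n + 1)).card = (visits P x v n).card + 1 := by
        rw [hV, Finset.card_insert_of_notMem (notMem_visits v n)]
      rw [sum_sub_sq] at ih ⊢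
      rw [hcard] at hc' ⊢
      rw [hV, Finset.sum_insert (notMem_visits v n)] at hc' ⊢
      rw [Finset.sum_insert (notMem_visits v n), Finset.sum_insert (notMem_visits v n)]
      rw [← hc] at ih hc' ⊢
      set N := (visits P x v n).card with hN
      set m := nodePred P x y v n
      set m' := nodePred P x y v (n + 1)
      rw [if_neg (Nat.succ_ne_zero N), harmonic_succ]
      push_cast at hc' ⊢
      rcases Nat.eq_zero_or_pos N with h0 | hpos
      · have hVe : visits P x v n = ∅ := Finset.card_eq_zero.1 h0
        have hm0 : m = 0 := by simp only [m, nodePred_eq, hVe]; simp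
        simp only [h0, hVe, hm0] at hc' ⊢
        simp at hc' ⊢
        rw [hc']
        have := sq_le_sq' hyn.1 hyn.2
        nlinarith
      · rw [if_neg hpos.ne'] at ih
        have hNp : (0 : ℝ) < N := by exact_mod_cast hpos
        -- The new mean is `m' = (N m + y n) / (N + 1)`.
        have hid : ((N : ℝ) + 1) * m' ^ 2 = (N * m + y n) ^ 2 * ((N : ℝ) + 1)⁻¹ := by
          rw [eq_mul_inv_iff_mul_eq₀ (by positivity)]
          linear_combination (((N : ℝ) + 1) * m' + (y n + N * m)) * hc'
        have hd : (m - y n) ^ 2 ≤ 4 * B ^ 2 := by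
          have := sq_le_sq' (a := m - y n) (b := 2 * B) (by linarith [hm.1, hyn.2])
            (by linarith [hm.2, hyn.1])
          linarith
        have hinv : ((N : ℝ) + 1) * ((N : ℝ) + 1)⁻¹ = 1 := mul_inv_cancel₀ (by positivity)
        have hip : 0 < ((N : ℝ) + 1)⁻¹ := by positivity
        have hstep := mul_le_mul_of_nonneg_right hd hip.le
        have hmm : 2 * m' * (y n + N * m) = 2 * (((N : ℝ) + 1) * m' ^ 2) := by
          rw [← hc']; ring
        rw [hmm, hid]
        have hfin : (N * m + y n) ^ 2 * ((N : ℝ) + 1)⁻¹ =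
            N * m ^ 2 + y n ^ 2 - (m - y n) ^ 2 + (m - y n) ^ 2 * ((N : ℝ) + 1)⁻¹ := by
          linear_combination (N * m ^ 2 + y n ^ 2 - (m - y n) ^ 2) * hinv
        rw [hfin]
        nlinarith
    · have hp : nodePred P x y v (n + 1) = nodePred P x y v n := by
        rw [nodePred_eq, nodePred_eq, visits_succ_of_notMem hx]
      rw [visits_succ_of_notMem hx, hp]
      exact ih

theorem harmonic_mono : Monotone harmonic :=
  monotone_nat_of_le_succ fun n => by
    rw [harmonic_succ]
    exact le_add_of_nonneg_right (by positivity)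

theorem sum_online_le {B : ℝ} (hB : 0 ≤ B) {n : ℕ} (hn : 1 ≤ n)
    (hy : ∀ s < n, y s ∈ Set.Icc (-B) B) (v : Word) :
    ∑ s ∈ visits P x v n, (nodePred P x y v s - y s) ^ 2 ≤
      ∑ s ∈ visits P x v n, (nodePred P x y v n - y s) ^ 2 +
        B ^ 2 * (4 * (harmonic n : ℝ) - 3) := by
  refine (sum_online_le_of_card hB hy v).trans ?_
  gcongr
  have hmono : ∀ {a b : ℕ}, a ≤ b → (harmonic a : ℝ) ≤ harmonic b := fun h => by
    exact_mod_cast harmonic_mono h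
  split_ifs
  -- An unvisited leaf costs nothing, and `4 H_n - 3 ≥ 1` since `n ≥ 1`.
  · have := hmono hn
    norm_num at this
    linarith
  · have := hmono (card_visits_le (P := P) (x := x) v n)
    linarith

/-! ### Splitting the rounds along a pruning -/

theorem sum_visits_eq_add (v : Word) (n : ℕ) (f : ℕ → ℝ) :
    ∑ s ∈ visits P x v n, f s =
      ∑ s ∈ visits P x (false :: v) n, f s + ∑ s ∈ visits P x (true :: v) n, f s := by
  classical
  rw [← Finset.sum_filter_add_sum_filter_not (visits P x v n) fun s => ¬ goesRight P v (x s)]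
  congr 1 <;> refine Finset.sum_congr ?_ fun _ _ => rfl <;> ext s <;>
    simp [mem_visits, cell, and_assoc]

theorem leafFrom_node_of_mem {l r : Pruning} {v : Word} {b : Bool} {z : Cube d}
    (h : z ∈ cell P (b :: v)) :
    (Pruning.node l r).leafFrom P z v = (if b then r else l).leafFrom P z (b :: v) := by
  cases b
  · rw [Pruning.leafFrom, if_neg h.2]; rfl
  · rw [Pruning.leafFrom, if_pos h.2]; rfl

theorem sum_visits_node (l r : Pruning) (v : Word) (n : ℕ) (f : Word → ℕ → ℝ) :
    ∑ s ∈ visits P x v n, f ((Pruning.node l r).leafFrom P (x s) v) s =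
      ∑ s ∈ visits P x (false :: v) n, f (l.leafFrom P (x s) (false :: v)) s +
      ∑ s ∈ visits P x (true :: v) n, f (r.leafFrom P (x s) (true :: v)) s := by
  rw [sum_visits_eq_add]
  congr 1 <;> refine Finset.sum_congr rfl fun s hs => ?_ <;>
    rw [leafFrom_node_of_mem (mem_visits.1 hs).2] <;> rfl

theorem sum_online_pruning_le {B : ℝ} (hB : 0 ≤ B) {n : ℕ} (hn : 1 ≤ n)
    (hy : ∀ s < n, y s ∈ Set.Icc (-B) B) (T : Pruning) (v : Word) :
    ∑ s ∈ visits P x v n, (nodePred P x y (T.leafFrom P (x s) v) s - y s) ^ 2 ≤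
      ∑ s ∈ visits P x v n, (nodePred P x y (T.leafFrom P (x s) v) n - y s) ^ 2 +
        T.leafCount * (B ^ 2 * (4 * (harmonic n : ℝ) - 3)) := by
  induction T generalizing v with
  | leaf =>
    simp only [Pruning.leafFrom, Pruning.leafCount, Nat.cast_one, one_mul]
    exact sum_online_le hB hn hy v
  | node l r hl hr =>
    rw [sum_visits_node l r v n fun w s => (nodePred P x y w s - y s) ^ 2,
      sum_visits_node l r v n fun w s => (nodePred P x y w n - y s) ^ 2]
    have h1 := hl (false :: v)
    have h2 := hr (true :: v)
    simp only [Pruning.leafCount, Nat.cast_add]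
    linarith

theorem visits_nil (n : ℕ) : visits P x [] n = Finset.range n := by
  ext s; simp [mem_visits, cell]

/-- The regret of the online leaf means of a pruning against its final leaf means. -/
theorem cumLoss_le {B : ℝ} (hB : 0 ≤ B) {n : ℕ} (hn : 1 ≤ n)
    (hy : ∀ s < n, y s ∈ Set.Icc (-B) B) (T : Pruning) :
    cumLoss P x y T n ≤ ∑ s ∈ Finset.range n, (treePred P x y T n (x s) - y s) ^ 2 +
        T.leafCount * (B ^ 2 * (4 * (harmonic n : ℝ) - 3)) := by
  have h := sum_online_pruning_le (P := P) (x := x) hB hn hy T []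
  rwa [visits_nil] at h

/-! ### The pruning of a finite time pruning -/

/-- The pruning `T`, hung at the node `v`, has the interior nodes and leaves of the time pruning
at `lam` below `v`. -/
def Pruning.Fits (P : InfTree d) (lam : ℝ) : Pruning → Word → Prop
  | .leaf, v => lam < (P v).2.2
  | .node l r, v => (P v).2.2 ≤ lam ∧ l.Fits P lam (false :: v) ∧ r.Fits P lam (true :: v)

variable {lam : ℝ}

/-- Words carry their last letter first, so `u ++ v` ranges over the descendants of `v`. -/
theorem birth_le_birth_append (hP : ∀ v, birth P v ≤ (P v).2.2) (u v : Word) :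
    birth P v ≤ birth P (u ++ v) := by
  induction u with
  | nil => exact le_rfl
  | cons b u ih => exact ih.trans (hP (u ++ v))

theorem cell_append_subset (u v : Word) : cell P (u ++ v) ⊆ cell P v := by
  induction u with
  | nil => exact subset_rfl
  | cons b u ih => cases b <;> exact fun z hz => ih hz.1

theorem mem_leaves_timePruning {v : Word} :
    v ∈ leaves (timePruning P lam) ↔ birth P v ≤ lam ∧ lam < (P v).2.2 := by
  simp [leaves, timePruning, birth]

theorem append_append_singleton (u v : Word) (b : Bool) : u.concat b ++ v = u ++ b :: v :=
  List.concat_append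

/-- Identifies the leaves reached in `T` with those of the time pruning, which makes the predictions
of `T` admissible competitors. -/
theorem Pruning.Fits.leafFrom_eq (hP : ∀ v, birth P v ≤ (P v).2.2) {T : Pruning} {u v : Word}
    (hT : T.Fits P lam v) (hu : u ++ v ∈ leaves (timePruning P lam)) {z : Cube d}
    (hz : z ∈ cell P (u ++ v)) : T.leafFrom P z v = u ++ v := by
  rw [mem_leaves_timePruning] at hu
  induction T generalizing u v with
  | leaf =>
    -- The last entry of `u` is the first step down from `v`. Such a step is impossible here: every
    -- strict descendant of `v` is born after `lam`.
    rcases List.eq_nil_or_concat u with rfl | ⟨u', b, rfl⟩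
    · rfl
    · have h := birth_le_birth_append hP u' (b :: v)
      rw [append_append_singleton] at hu
      exact absurd (hT.trans_le (h.trans hu.1)) (lt_irrefl _)
  | node l r hl hr =>
    rcases List.eq_nil_or_concat u with rfl | ⟨u', b, rfl⟩
    · exact absurd (hu.2.trans_le hT.1) (lt_irrefl _)
    · rw [append_append_singleton] at hu hz ⊢
      rw [leafFrom_node_of_mem (cell_append_subset u' (b :: v) hz)]
      cases b
      · exact hl hT.2.1 hu hz
      · exact hr hT.2.2 hu hz

theorem Pruning.Fits.constOnCells (hP : ∀ v, birth P v ≤ (P v).2.2) {T : Pruning}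
    (hT : T.Fits P lam []) (f : Word → ℝ) : ConstOnCells P lam fun z => f (T.leafOf P z) := by
  have key : ∀ v ∈ leaves (timePruning P lam), ∀ z ∈ cell P v, T.leafOf P z = v := by
    intro v hv z hz
    have h := hT.leafFrom_eq hP (u := v) (z := z) (by rwa [List.append_nil])
      (by rwa [List.append_nil])
    rwa [List.append_nil] at h
  intro v hv z hz z' hz'
  simp only [key v hv z hz, key v hv z' hz']

theorem Pruning.Fits.sum_le {T : Pruning} {v : Word} (hT : T.Fits P lam v) (hv : birth P v ≤ lam)
    {g : Cube d → ℝ} (hg : ConstOnCells P lam g) (n : ℕ) :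
    ∑ s ∈ visits P x v n, (nodePred P x y (T.leafFrom P (x s) v) n - y s) ^ 2 ≤
      ∑ s ∈ visits P x v n, (g (x s) - y s) ^ 2 := by
  induction T generalizing v with
  | leaf =>
    have hleaf : v ∈ leaves (timePruning P lam) := mem_leaves_timePruning.2 ⟨hv, hT⟩
    rcases (visits P x v n).eq_empty_or_nonempty with h | ⟨s₀, hs₀⟩
    · simp [h]
    · refine (sum_nodePred_sub_sq_le v n (g (x s₀))).trans (le_of_eq ?_)
      refine Finset.sum_congr rfl fun s hs => ?_
      rw [hg v hleaf _ (mem_visits.1 hs₀).2 _ (mem_visits.1 hs).2]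
  | node l r hl hr =>
    rw [sum_visits_node l r v n fun w s => (nodePred P x y w n - y s) ^ 2,
      sum_visits_eq_add v n fun s => (g (x s) - y s) ^ 2]
    exact add_le_add (hl hT.2.1 hT.1) (hr hT.2.2 hT.1)

/-- The least loss of a function constant on the cells of a time pruning is that of the
leaf means. -/
theorem Pruning.Fits.iInf_eq (hP : ∀ v, birth P v ≤ (P v).2.2) (hlam : 0 ≤ lam) {T : Pruning}
    (hT : T.Fits P lam []) (n : ℕ) :
    ⨅ g : {g : Cube d → ℝ // ConstOnCells P lam g},
        ∑ t ∈ Finset.range n, (g.1 (x t) - y t) ^ 2 =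
      ∑ t ∈ Finset.range n, (treePred P x y T n (x t) - y t) ^ 2 := by
  refine IsLeast.csInf_eq ⟨⟨⟨_, hT.constOnCells hP fun w => nodePred P x y w n⟩, rfl⟩, ?_⟩
  rintro _ ⟨g, rfl⟩
  have h := hT.sum_le (x := x) (y := y) hlam g.2 n
  rwa [visits_nil] at h

/-! ### Counting the leaves of a time pruning -/

open Classical in
/-- The number of leaves of the time pruning at `lam` below `v`, cut at relative depth `k`. -/
def truncCount (P : InfTree d) (lam : ℝ) : ℕ → Word → ℕ
  | 0, _ => 1
  | k + 1, v => if (P v).2.2 ≤ lam then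
      truncCount P lam k (false :: v) + truncCount P lam k (true :: v) else 1

theorem one_le_truncCount (k : ℕ) (v : Word) : 1 ≤ truncCount P lam k v := by
  induction k generalizing v with
  | zero => exact le_rfl
  | succ k ih =>
    rw [truncCount]
    split_ifs
    · exact (ih _).trans (Nat.le_add_right _ _)
    · exact le_rfl

theorem monotone_truncCount (v : Word) : Monotone fun k => truncCount P lam k v := by
  refine monotone_nat_of_le_succ fun k => ?_
  induction k generalizing v with
  | zero => exact one_le_truncCount 1 v
  | succ k ih =>
    rw [truncCount, truncCount]
    split_ifs
    · exact add_le_add (ih _) (ih _)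
    · exact le_rfl

theorem Pruning.Fits.leafCount_le {T : Pruning} {v : Word} (hT : T.Fits P lam v) {k : ℕ}
    (hk : T.size ≤ k) : T.leafCount ≤ truncCount P lam k v := by
  induction T generalizing v k with
  | leaf => exact one_le_truncCount k v
  | node l r hl hr =>
    simp only [Pruning.size] at hk
    obtain ⟨k, rfl⟩ : ∃ m, k = m + 1 := ⟨k - 1, by omega⟩
    rw [truncCount, if_pos hT.1]
    exact add_le_add (hl hT.2.1 (by omega)) (hr hT.2.2 (by omega))

/-- As in König's lemma, if nothing finite fits at `v`, then `v` is split by time `lam` and nothing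
finite fits at one of its children. That child contributes more than `k` leaves and its sibling at
least one more. -/
theorem lt_truncCount {v : Word} (h : ∀ T : Pruning, ¬ T.Fits P lam v) (k : ℕ) :
    k < truncCount P lam k v := by
  induction k generalizing v with
  | zero => exact Nat.one_pos
  | succ k ih =>
    have hv : (P v).2.2 ≤ lam := not_lt.1 (h .leaf)
    rw [truncCount, if_pos hv]
    by_cases hl : ∃ l : Pruning, l.Fits P lam (false :: v)
    · obtain ⟨l, hl⟩ := hl
      have := ih (v := true :: v) fun r hr => h (.node l r) ⟨hv, hl, hr⟩
      have := one_le_truncCount (P := P) (lam := lam) k (false :: v)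
      omega
    · have := ih (v := false :: v) (not_exists.1 hl)
      have := one_le_truncCount (P := P) (lam := lam) k (true :: v)
      omega

end Regret

/-! ### Measurability in the tree -/

section Measurability

variable {d : ℕ}

theorem measurableSet_goesRight (v : Word) (z : Cube d) :
    MeasurableSet {P : InfTree d | goesRight P v z} := by
  have h : Measurable fun P : InfTree d => (P v).2.1 := (measurable_pi_apply v).snd.fst
  have h' : Measurable fun P : InfTree d => ((z (P v).1 : unitInterval) : ℝ) :=
    (measurable_from_top (f := fun j : Fin d => ((z j : unitInterval) : ℝ))).comp
      (measurable_pi_apply v).fst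
  exact measurableSet_lt h h'

theorem measurableSet_mem_cell (v : Word) (z : Cube d) :
    MeasurableSet {P : InfTree d | z ∈ cell P v} := by
  induction v with
  | nil => simp [cell]
  | cons b v ih =>
    cases b
    · exact ih.inter (measurableSet_goesRight v z).compl
    · exact ih.inter (measurableSet_goesRight v z)

theorem measurable_nodePred (x : ℕ → Cube d) (y : ℕ → ℝ) (v : Word) (t : ℕ) :
    Measurable fun P : InfTree d => nodePred P x y v t := by
  classical
  unfold nodePred
  simp only [Finset.card_filter, Finset.sum_filter, Nat.cast_sum]
  refine Measurable.div ?_ ?_ <;> refine Finset.measurable_sum _ fun s _ => ?_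
  · exact Measurable.ite (measurableSet_mem_cell v (x s)) measurable_const measurable_const
  · exact (measurable_from_top (f := fun k : ℕ => (k : ℝ))).comp
      (Measurable.ite (measurableSet_mem_cell v (x s)) measurable_const measurable_const)

theorem measurable_treePred (x : ℕ → Cube d) (y : ℕ → ℝ) (T : Pruning) (t : ℕ) (z : Cube d) :
    Measurable fun P : InfTree d => treePred P x y T t z := by
  classical
  suffices h : ∀ v, Measurable fun P : InfTree d => nodePred P x y (T.leafFrom P z v) t from h []
  induction T with
  | leaf => exact fun v => measurable_nodePred x y v t
  | node l r hl hr =>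
    intro v
    have : (fun P : InfTree d => nodePred P x y ((Pruning.node l r).leafFrom P z v) t) =
        fun P => if goesRight P v z then nodePred P x y (r.leafFrom P z (true :: v)) t
          else nodePred P x y (l.leafFrom P z (false :: v)) t := by
      funext P
      rw [Pruning.leafFrom]
      split_ifs <;> rfl
    rw [this]
    exact Measurable.ite (measurableSet_goesRight v z) (hr _) (hl _)

theorem measurable_aggWeight (η : ℝ) (x : ℕ → Cube d) (y : ℕ → ℝ) (t : ℕ) (T : Pruning) :
    Measurable fun P : InfTree d => aggWeight η P x y t T := by
  unfold aggWeight cumLoss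
  refine measurable_const.mul (Real.measurable_exp.comp (measurable_const.mul ?_))
  exact Finset.measurable_sum _ fun s _ =>
    ((measurable_treePred x y T s (x s)).sub_const _).pow_const 2

/-- The sum is the pointwise limit of its finite partial sums along a filter that is countably
generated because `β` is countable. -/
theorem measurable_tsum_of_summable {α β : Type*} [MeasurableSpace α] [Countable β]
    {f : β → α → ℝ} (hf : ∀ b, Measurable (f b)) (hs : ∀ a, Summable fun b => f b a) :
    Measurable fun a => ∑' b, f b a :=
  measurable_of_tendsto_metrizable' Filter.atTop
    (fun s : Finset β => Finset.measurable_sum s fun b _ => hf b)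
    (tendsto_pi_nhds.2 fun a => (hs a).hasSum)

/-- A bound uniform in `P` and `v` for arbitrary labels, which gives the summability behind
`measurable_amf`. -/
theorem abs_nodePred_le (P : InfTree d) (x : ℕ → Cube d) (y : ℕ → ℝ) (v : Word) (t : ℕ) :
    |nodePred P x y v t| ≤ ∑ s ∈ Finset.range t, |y s| := by
  have h0 : 0 ≤ ∑ s ∈ Finset.range t, |y s| := Finset.sum_nonneg fun _ _ => abs_nonneg _
  refine abs_le.2 (nodePred_mem_Icc (neg_nonpos.2 h0) h0 (fun s hs => abs_le.1 ?_) v)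
  exact Finset.single_le_sum (f := fun s => |y s|) (fun _ _ => abs_nonneg _)
    (Finset.mem_range.2 hs)

theorem measurable_amf {η : ℝ} (hη : 0 ≤ η) (x : ℕ → Cube d) (y : ℕ → ℝ) (t : ℕ) (z : Cube d) :
    Measurable fun P : InfTree d => amf η P x y t z :=
  (measurable_tsum_of_summable
    (fun T => (measurable_aggWeight η x y t T).mul (measurable_treePred x y T t z))
    fun P => summable_aggWeight_mul hη t fun _ => abs_nodePred_le P x y _ t).div
  (measurable_tsum_of_summable (measurable_aggWeight η x y t) fun _ => summable_aggWeight hη t)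

theorem measurable_splitTime (v : Word) : Measurable fun P : InfTree d => (P v).2.2 :=
  (measurable_pi_apply v).snd.snd

theorem measurable_birth (v : Word) : Measurable fun P : InfTree d => birth P v := by
  cases v with
  | nil => exact measurable_const
  | cons b v => exact measurable_splitTime v

theorem measurableSet_fits (lam : ℝ) (T : Pruning) (v : Word) :
    MeasurableSet {P : InfTree d | T.Fits P lam v} := by
  induction T generalizing v with
  | leaf => exact measurableSet_lt measurable_const (measurable_splitTime v)
  | node l r hl hr =>
    exact (measurableSet_le (measurable_splitTime v) measurable_const).inter
      ((hl _).inter (hr _))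

theorem measurable_truncCount (lam : ℝ) (k : ℕ) (v : Word) :
    Measurable fun P : InfTree d => truncCount P lam k v := by
  classical
  induction k generalizing v with
  | zero => exact measurable_const
  | succ k ih =>
    unfold truncCount
    exact Measurable.ite (measurableSet_le (measurable_splitTime v) measurable_const)
      ((ih _).add (ih _)) measurable_const

/-- The infimum runs over an uncountable family that depends on `P`. On each of the countably many
events `T.Fits` it is almost everywhere the measurable loss of the leaf means of `T`, and these
events cover almost every tree. -/
theorem aemeasurable_iInf {μ : Measure (InfTree d)} {lam : ℝ} (hlam : 0 ≤ lam)
    (hbirth : ∀ᵐ P ∂μ, ∀ v, birth P v ≤ (P v).2.2) (hfits : ∀ᵐ P ∂μ, ∃ T : Pruning, T.Fits P lam [])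
    (x : ℕ → Cube d) (y : ℕ → ℝ) (n : ℕ) :
    AEMeasurable (fun P : InfTree d => ⨅ g : {g : Cube d → ℝ // ConstOnCells P lam g},
        ∑ t ∈ Finset.range n, (g.1 (x t) - y t) ^ 2) μ := by
  have hun : μ.restrict (⋃ T : Pruning, {P : InfTree d | T.Fits P lam []}) = μ := by
    rw [Measure.restrict_eq_self_of_ae_mem]
    filter_upwards [hfits] with P hP
    simpa using hP
  rw [← hun, aemeasurable_iUnion_iff]
  intro T
  refine AEMeasurable.congr (f := fun P => ∑ t ∈ Finset.range n,
    (treePred P x y T n (x t) - y t) ^ 2) (Measurable.aemeasurable ?_) ?_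
  · exact Finset.measurable_sum _ fun s _ =>
      ((measurable_treePred x y T n (x s)).sub_const _).pow_const 2
  · filter_upwards [ae_restrict_mem (measurableSet_fits lam T []), ae_restrict_of_ae hbirth]
      with P hT hP
    exact (Pruning.Fits.iInf_eq hP hlam hT n).symm

end Measurability

/-! ### The regret bound for one tree -/

/-- Turns a comparison of integer powers into the lower bound `(b / a) log 2` for `log n`. -/
theorem mul_log_two_le {a b n m : ℕ} (h : 2 ^ b ≤ m ^ a) (hmn : m ≤ n) (hm : 0 < m) :
    (b : ℝ) * Real.log 2 ≤ a * Real.log n := by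
  have h1 : ((2 : ℝ) ^ b) ≤ (m : ℝ) ^ a := by exact_mod_cast h
  have h2 := Real.log_le_log (by positivity) h1
  rw [Real.log_pow, Real.log_pow] at h2
  have h3 : Real.log m ≤ Real.log n :=
    Real.log_le_log (by exact_mod_cast hm) (by exact_mod_cast hmn)
  exact h2.trans (mul_le_mul_of_nonneg_left h3 (Nat.cast_nonneg a))

/-- Here `r` is the regret divided by `B²`. With `H_n ≤ 1 + log n`, `h1` suffices from `n = 6`,
`11`, `21` on for `K = 1`, `K = 2`, `K ≥ 3`; below these thresholds exact harmonic numbers or `h2`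
are used. -/
theorem le_mul_log_of_le {K n : ℕ} (hK : 1 ≤ K) (hn : 2 ≤ n) {r : ℝ}
    (h1 : r ≤ 8 * Real.log 2 * (2 * K - 1) + K * (4 * (harmonic n : ℝ) - 3))
    (h2 : r ≤ 4 * n - 3) (h3 : K = 1 → n = 3 → r ≤ 7) : r ≤ 8 * K * Real.log n := by
  have hL := Real.log_two_gt_d9
  have hL' := Real.log_two_lt_d9
  have hH : (harmonic n : ℝ) ≤ 1 + Real.log n := harmonic_le_one_add_log n
  have hlog : 0 ≤ Real.log n := Real.log_natCast_nonneg n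
  obtain rfl | rfl | hK3 : K = 1 ∨ K = 2 ∨ 3 ≤ K := by omega
  · norm_num at h1 ⊢
    rcases le_or_gt 6 n with h6 | h6
    · have := mul_log_two_le (a := 2) (b := 5) (m := 6) (by norm_num) h6 (by norm_num)
      norm_num at this
      linarith
    interval_cases n
    · norm_num at h2 ⊢; linarith
    -- For `K = 1`, `n = 3` the target is `8 log 3 ≈ 8.79`, whereas `h1` gives about `9.88` and `h2`
    -- gives `9`; only `h3` is good enough.
    · have := mul_log_two_le (a := 2) (b := 3) (m := 3) (by norm_num) le_rfl (by norm_num)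
      have := h3 rfl rfl
      norm_num at *
      linarith
    · have := mul_log_two_le (a := 1) (b := 2) (m := 4) (by norm_num) le_rfl (by norm_num)
      norm_num [harmonic, Finset.sum_range_succ] at *
      linarith
    · have := mul_log_two_le (a := 4) (b := 9) (m := 5) (by norm_num) le_rfl (by norm_num)
      norm_num [harmonic, Finset.sum_range_succ] at *
      linarith
  · norm_num at h1 ⊢
    rcases le_or_gt 11 n with h6 | h6
    · have := mul_log_two_le (a := 5) (b := 17) (m := 11) (by norm_num) h6 (by norm_num)
      norm_num at this
      linarith
    rcases le_or_gt 10 n with h6 | h6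
    · obtain rfl : n = 10 := by omega
      have := mul_log_two_le (a := 4) (b := 13) (m := 10) (by norm_num) le_rfl (by norm_num)
      norm_num [harmonic, Finset.sum_range_succ] at *
      linarith
    have hcast : ∀ {m : ℕ}, n ≤ m → (n : ℝ) ≤ m := fun h => by exact_mod_cast h
    obtain h | h | h | h | h : n = 2 ∨ n = 3 ∨ (4 ≤ n ∧ n ≤ 6) ∨ n = 7 ∨ (8 ≤ n ∧ n ≤ 9) := by
      omega
    · subst h; norm_num at h2 ⊢; linarith
    · have := mul_log_two_le (a := 2) (b := 3) (n := n) (m := 3) (by norm_num) h.ge (by norm_num)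
      have hc := hcast h.le
      push_cast at this hc
      linarith
    · have := mul_log_two_le (a := 1) (b := 2) (m := 4) (by norm_num) h.1 (by norm_num)
      have hc := hcast h.2
      push_cast at this hc
      linarith
    · have := mul_log_two_le (a := 2) (b := 5) (n := n) (m := 7) (by norm_num) h.ge (by norm_num)
      have hc := hcast h.le
      push_cast at this hc
      linarith
    · have := mul_log_two_le (a := 1) (b := 3) (m := 8) (by norm_num) h.1 (by norm_num)
      have hc := hcast h.2
      push_cast at this hc
      linarith
  · have hKr : (3 : ℝ) ≤ K := by exact_mod_cast hK3
    -- Replacing `2K - 1` by `2K` makes both sides proportional to `K`.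
    have hbig : 16 * Real.log 2 + (4 * (harmonic n : ℝ) - 3) ≤ 8 * Real.log n →
        r ≤ 8 * K * Real.log n := fun h => by
      have := mul_le_mul_of_nonneg_left h (show (0 : ℝ) ≤ K by positivity)
      linarith
    have hsmall : (4 * n - 3 : ℝ) ≤ 24 * Real.log n → r ≤ 8 * K * Real.log n := fun h => by
      have := mul_le_mul_of_nonneg_right hKr hlog
      linarith
    have hcast : ∀ {m : ℕ}, n ≤ m → (n : ℝ) ≤ m := fun h => by exact_mod_cast h
    rcases le_or_gt 21 n with h6 | h6
    · apply hbig
      have := mul_log_two_le (a := 8) (b := 35) (m := 21) (by norm_num) h6 (by norm_num)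
      norm_num at this
      linarith
    rcases le_or_gt 19 n with h6 | h6
    · apply hbig
      have := mul_log_two_le (a := 5) (b := 21) (m := 19) (by norm_num) h6 (by norm_num)
      have hmono : (harmonic n : ℝ) ≤ harmonic 20 := by
        exact_mod_cast harmonic_mono (by omega : n ≤ 20)
      norm_num [harmonic, Finset.sum_range_succ] at this hmono ⊢
      linarith
    apply hsmall
    obtain h | h | h | h | h : (2 ≤ n ∧ n ≤ 4) ∨ (5 ≤ n ∧ n ≤ 7) ∨ (8 ≤ n ∧ n ≤ 13) ∨
        (14 ≤ n ∧ n ≤ 16) ∨ (17 ≤ n ∧ n ≤ 18) := by omega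
    · have := mul_log_two_le (a := 1) (b := 1) (m := 2) (by norm_num) h.1 (by norm_num)
      have hc := hcast h.2
      push_cast at this hc
      linarith
    · have := mul_log_two_le (a := 1) (b := 2) (m := 5) (by norm_num) h.1 (by norm_num)
      have hc := hcast h.2
      push_cast at this hc
      linarith
    · have := mul_log_two_le (a := 1) (b := 3) (m := 8) (by norm_num) h.1 (by norm_num)
      have hc := hcast h.2
      push_cast at this hc
      linarith
    · have := mul_log_two_le (a := 4) (b := 15) (m := 14) (by norm_num) h.1 (by norm_num)
      have hc := hcast h.2
      push_cast at this hc
      linarith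
    · rcases h.1.eq_or_lt with h17 | h17
      · have := mul_log_two_le (a := 1) (b := 4) (m := 17) (by norm_num) h.1 (by norm_num)
        subst h17
        norm_num at *
        linarith
      · have := mul_log_two_le (a := 6) (b := 25) (m := 18) (by norm_num) h17 (by norm_num)
        have hc := hcast h.2
        push_cast at this hc
        linarith

section RegretBound

variable {d : ℕ} {P : InfTree d} {x : ℕ → Cube d} {y : ℕ → ℝ}

theorem amf_loss_le {η B : ℝ} (hη : 0 ≤ η) (hB : 0 ≤ B) {t : ℕ}
    (hy : ∀ s ≤ t, y s ∈ Set.Icc (-B) B) : (amf η P x y t (x t) - y t) ^ 2 ≤ 4 * B ^ 2 := by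
  have h1 : amf η P x y t (x t) ∈ Set.Icc (-B) B :=
    amf_mem_Icc hη (neg_nonpos.2 hB) hB (fun s hs => hy s hs.le) _
  have h2 := hy t le_rfl
  have := sq_le_sq' (a := amf η P x y t (x t) - y t) (b := 2 * B) (by linarith [h1.1, h2.2])
    (by linarith [h1.2, h2.1])
  linarith

theorem amf_zero_eq {η : ℝ} (hη : 0 ≤ η) (z : Cube d) : amf η P x y 0 z = 0 := by
  have h := amf_mem_Icc (P := P) (x := x) (y := y) hη le_rfl le_rfl (t := 0)
    (fun s hs => absurd hs (Nat.not_lt_zero s)) z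
  exact le_antisymm h.2 h.1

/-- The first forecast is `0` and costs at most `B²`; every later round costs at most `4B²`. -/
theorem sum_amf_loss_le_trivial {η B : ℝ} (hη : 0 ≤ η) (hB : 0 ≤ B) {n : ℕ} (hn : 1 ≤ n)
    (hy : ∀ s < n, y s ∈ Set.Icc (-B) B) :
    ∑ t ∈ Finset.range n, (amf η P x y t (x t) - y t) ^ 2 ≤ B ^ 2 * (4 * n - 3) := by
  obtain ⟨m, rfl⟩ : ∃ m, n = m + 1 := ⟨n - 1, by omega⟩
  rw [Finset.sum_range_succ', amf_zero_eq hη]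
  have h0 := sq_le_sq' (hy 0 m.succ_pos).1 (hy 0 m.succ_pos).2
  have h1 := Finset.sum_le_card_nsmul (Finset.range m)
    (fun t => (amf η P x y (t + 1) (x (t + 1)) - y (t + 1)) ^ 2) (4 * B ^ 2) fun t ht =>
      amf_loss_le hη hB fun s hs => hy s (by have := Finset.mem_range.1 ht; omega)
  rw [Finset.card_range, nsmul_eq_mul] at h1
  push_cast
  linarith

/-- Three rounds against the best constant: the second prediction lies between `0` and `y 0`. -/
theorem sum_three_amf_loss_le {η B : ℝ} (hη : 0 ≤ η) (hB : 0 ≤ B)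
    (hy : ∀ s < 3, y s ∈ Set.Icc (-B) B) (c : ℝ) :
    ∑ t ∈ Finset.range 3, (amf η P x y t (x t) - y t) ^ 2 ≤
      ∑ t ∈ Finset.range 3, (c - y t) ^ 2 + B ^ 2 * 7 := by
  simp only [Finset.sum_range_succ, Finset.sum_range_zero, zero_add]
  rw [amf_zero_eq hη]
  have h2 := amf_loss_le (P := P) (x := x) (y := y) (t := 2) hη hB fun s hs => hy s (by omega)
  have hp : amf η P x y 1 (x 1) ∈ Set.Icc (min 0 (y 0)) (max 0 (y 0)) :=
    amf_mem_Icc hη (min_le_left _ _) (le_max_left _ _) (fun s hs => by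
      obtain rfl : s = 0 := by omega
      exact ⟨min_le_right _ _, le_max_right _ _⟩) _
  set p := amf η P x y 1 (x 1)
  have hy0 := hy 0 (by norm_num)
  have hy1 := hy 1 (by norm_num)
  have q0 := sq_le_sq' hy0.1 hy0.2
  have q1 := sq_le_sq' hy1.1 hy1.2
  have q01 := sq_le_sq' (a := y 0 - y 1) (b := 2 * B) (by linarith [hy0.1, hy1.2])
    (by linarith [hy0.2, hy1.1])
  have hc : (y 0 - y 1) ^ 2 / 2 ≤ (c - y 0) ^ 2 + (c - y 1) ^ 2 := by
    nlinarith [sq_nonneg (2 * c - y 0 - y 1)]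
  -- The distance from `y 1` to a point between `0` and `y 0` is largest at an endpoint.
  have hmax : (p - y 1) ^ 2 ≤ y 1 ^ 2 ∨ (p - y 1) ^ 2 ≤ (y 0 - y 1) ^ 2 := by
    rcases le_total (y 0) 0 with h | h
    · rw [min_eq_right h, max_eq_left h] at hp
      rcases le_total p (y 1) with h' | h'
      · right; nlinarith [hp.1]
      · left; nlinarith [hp.2]
    · rw [min_eq_left h, max_eq_right h] at hp
      rcases le_total p (y 1) with h' | h'
      · left; nlinarith [hp.1]
      · right; nlinarith [hp.2]
  -- In units of `B²`, the first case gives `1 + 1 + 4`. In the second, `hc` absorbs half of `(y 0 -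
  -- y 1)² ≤ 4B²`, which gives `1 + 2 + 4 = 7`.
  rcases hmax with h | h <;> nlinarith [sq_nonneg (c - y 2), sq_nonneg (c - y 0),
    sq_nonneg (c - y 1)]

/-- The regret of the forecaster against the functions constant on the cells of a finite time
pruning. -/
theorem Pruning.Fits.regret_le {B lam : ℝ} (hB : 0 < B) (hlam : 0 ≤ lam)
    (hP : ∀ v, birth P v ≤ (P v).2.2) {T : Pruning} (hT : T.Fits P lam []) {n : ℕ} (hn : 2 ≤ n)
    (hy : ∀ s < n, y s ∈ Set.Icc (-B) B) :
    ∑ t ∈ Finset.range n, (amf (1 / (8 * B ^ 2)) P x y t (x t) - y t) ^ 2 ≤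
      (⨅ g : {g : Cube d → ℝ // ConstOnCells P lam g},
        ∑ t ∈ Finset.range n, (g.1 (x t) - y t) ^ 2) +
      8 * B ^ 2 * Real.log n * T.leafCount := by
  rw [hT.iInf_eq hP hlam]
  have hη : 0 ≤ 1 / (8 * B ^ 2) := by positivity
  have hB2 : 0 < B ^ 2 := by positivity
  have ha := (sum_amf_loss_le (P := P) (x := x) hB hy T).trans
    (add_le_add_left (cumLoss_le (P := P) (x := x) hB.le (by omega) hy T) _)
  have hb := sum_amf_loss_le_trivial (P := P) (x := x) hη hB.le (by omega) hy
  have hc : T.leafCount = 1 → n = 3 →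
      ∑ t ∈ Finset.range n, (amf (1 / (8 * B ^ 2)) P x y t (x t) - y t) ^ 2 ≤
        ∑ t ∈ Finset.range n, (treePred P x y T n (x t) - y t) ^ 2 + B ^ 2 * 7 := by
    rintro h1 rfl
    cases T with
    | leaf => exact sum_three_amf_loss_le hη hB.le hy (nodePred P x y [] 3)
    | node l r =>
      have := l.one_le_leafCount
      have := r.one_le_leafCount
      simp only [Pruning.leafCount] at h1
      omega
  have hF : 0 ≤ ∑ t ∈ Finset.range n, (treePred P x y T n (x t) - y t) ^ 2 :=
    Finset.sum_nonneg fun _ _ => sq_nonneg _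
  have hsize : (T.size : ℝ) = 2 * T.leafCount - 1 := by
    rw [eq_sub_iff_add_eq]
    exact_mod_cast T.size_add_one
  rw [hsize] at ha
  set F := ∑ t ∈ Finset.range n, (treePred P x y T n (x t) - y t) ^ 2
  set R := ∑ t ∈ Finset.range n, (amf (1 / (8 * B ^ 2)) P x y t (x t) - y t) ^ 2
  have key := le_mul_log_of_le (r := (R - F) / B ^ 2) T.one_le_leafCount hn
    (by rw [div_le_iff₀ hB2]; linarith) (by rw [div_le_iff₀ hB2]; linarith)
    (fun h h' => by rw [div_le_iff₀ hB2]; linarith [hc h h'])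
  rw [div_le_iff₀ hB2] at key
  linarith

end RegretBound

/-! ### One step of the sampling -/

section OneStep

variable {d : ℕ}

/-- The expected number of leaves, after time `s`, of a Mondrian on the box `C`. -/
def Box.expectedLeaves (C : Box d) (s : ℝ) : ℝ := ∏ j, (1 + C.side j * s)

/-- The expected number of leaves for the box `C` without its side `j`. -/
def Box.expectedLeavesErase (C : Box d) (j : Fin d) (s : ℝ) : ℝ :=
  ∏ i ∈ Finset.univ.erase j, (1 + C.side i * s)

theorem Box.expectedLeaves_eq (C : Box d) (j : Fin d) (s : ℝ) :
    C.expectedLeaves s = (1 + C.side j * s) * C.expectedLeavesErase j s :=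
  (Finset.mul_prod_erase _ _ (Finset.mem_univ j)).symm

theorem Box.one_le_expectedLeaves {C : Box d} (hC : ∀ j, 0 ≤ C.side j) {s : ℝ} (hs : 0 ≤ s) :
    1 ≤ C.expectedLeaves s := by
  unfold Box.expectedLeaves
  refine Finset.prod_induction _ (fun r : ℝ => 1 ≤ r)
    (fun a b ha hb => one_le_mul_of_one_le_of_one_le ha hb) le_rfl fun j _ => ?_
  have := mul_nonneg (hC j) hs
  linarith

theorem Box.expectedLeavesErase_nonneg {C : Box d} (hC : ∀ j, 0 ≤ C.side j) (j : Fin d) {s : ℝ}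
    (hs : 0 ≤ s) : 0 ≤ C.expectedLeavesErase j s :=
  Finset.prod_nonneg fun i _ => by
    have := mul_nonneg (hC i) hs
    linarith

theorem Box.side_child_self (C : Box d) (j : Fin d) (u : ℝ) (b : Bool) :
    (C.child j ((C j).1 + u * C.side j) b).side j = if b then (1 - u) * C.side j
      else u * C.side j := by
  cases b <;> simp [Box.side, Box.child]
  ring

theorem Box.side_child_of_ne (C : Box d) {i j : Fin d} (h : i ≠ j) (θ : ℝ) (b : Bool) :
    (C.child j θ b).side i = C.side i := by
  simp [Box.side, Box.child, h]

theorem Box.side_child_nonneg {C : Box d} (hC : ∀ j, 0 ≤ C.side j) (j : Fin d) {u : ℝ}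
    (hu : u ∈ Set.Icc (0 : ℝ) 1) (b : Bool) (i : Fin d) :
    0 ≤ (C.child j ((C j).1 + u * C.side j) b).side i := by
  by_cases h : i = j
  · subst h
    rw [Box.side_child_self]
    split_ifs
    exacts [mul_nonneg (by linarith [hu.2]) (hC i), mul_nonneg hu.1 (hC i)]
  · rw [Box.side_child_of_ne C h]
    exact hC i

theorem Box.side_child_pos {C : Box d} (hC : ∀ j, 0 < C.side j) (j : Fin d) {u : ℝ}
    (hu : u ∈ Set.Ioo (0 : ℝ) 1) (b : Bool) (i : Fin d) :
    0 < (C.child j ((C j).1 + u * C.side j) b).side i := by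
  by_cases h : i = j
  · subst h
    rw [Box.side_child_self]
    split_ifs
    exacts [mul_pos (by linarith [hu.2]) (hC i), mul_pos hu.1 (hC i)]
  · rw [Box.side_child_of_ne C h]
    exact hC i

/-- Only factor `j` changes, and `(1 + u a s) + (1 + (1 - u) a s) = (1 + a s) + 1` with `a = |C^j|`;
the threshold cancels. -/
theorem Box.expectedLeaves_child_add (C : Box d) (j : Fin d) (u s : ℝ) :
    (C.child j ((C j).1 + u * C.side j) false).expectedLeaves s +
      (C.child j ((C j).1 + u * C.side j) true).expectedLeaves s =
    C.expectedLeaves s + C.expectedLeavesErase j s := by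
  have h : ∀ b, (C.child j ((C j).1 + u * C.side j) b).expectedLeavesErase j s =
      C.expectedLeavesErase j s := fun b =>
    Finset.prod_congr rfl fun i hi => by rw [Box.side_child_of_ne C (Finset.ne_of_mem_erase hi)]
  rw [Box.expectedLeaves_eq _ j, Box.expectedLeaves_eq _ j, Box.expectedLeaves_eq C j, h, h,
    Box.side_child_self, Box.side_child_self]
  simp only [Bool.false_eq_true, if_false, if_true]
  ring

theorem Box.hasDerivAt_expectedLeaves (C : Box d) (s : ℝ) :
    HasDerivAt C.expectedLeaves (∑ j, C.side j * C.expectedLeavesErase j s) s := by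
  have h := HasDerivAt.fun_finsetProd (u := Finset.univ) (x := s)
    (f := fun (j : Fin d) (s : ℝ) => 1 + C.side j * s) (f' := fun j => C.side j)
    fun j _ => by simpa using ((hasDerivAt_id s).const_mul (C.side j)).const_add 1
  refine h.congr_deriv (Finset.sum_congr rfl fun j _ => ?_)
  rw [smul_eq_mul, mul_comm]
  rfl

theorem Box.continuous_expectedLeavesErase (C : Box d) (j : Fin d) :
    Continuous (C.expectedLeavesErase j) := by
  unfold Box.expectedLeavesErase
  fun_prop

theorem measurable_expectedLeaves {α : Type*} [MeasurableSpace α] {C : α → Box d} {s : α → ℝ}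
    (hC : Measurable C) (hs : Measurable s) : Measurable fun a => (C a).expectedLeaves (s a) := by
  unfold Box.expectedLeaves
  exact Finset.measurable_prod _ fun j _ =>
    (((measurable_side j).comp hC).mul hs).const_add 1

variable [NeZero d]

theorem Box.linDim_pos {C : Box d} (hC : ∀ j, 0 < C.side j) : 0 < C.linDim :=
  Finset.sum_pos (fun j _ => hC j) Finset.univ_nonempty

/-- Inversion selects `j` only for `u` between consecutive normalized partial sums of the sides,
apart from the fallback value, which can occur only at `u = 1`. An upper bound is all that is
needed. -/
theorem volume_splitDim_eq_le {C : Box d} (hC : ∀ j, 0 < C.side j) (j : Fin d) :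
    volume {u : unitInterval | splitDim C u = j} ≤ ENNReal.ofReal (C.side j / C.linDim) := by
  have hA := Box.linDim_pos hC
  set a := (∑ i ∈ Finset.Iio j, C.side i) / C.linDim
  set b := (∑ i ∈ Finset.Iic j, C.side i) / C.linDim
  have hab : b - a = C.side j / C.linDim := by
    rw [← sub_div, ← Finset.Iio_insert, Finset.sum_insert (by simp)]
    ring
  have hsub : Subtype.val '' {u : unitInterval | splitDim C u = j} ⊆ Set.Icc a b ∪ {1} := by
    rintro _ ⟨u, hu, rfl⟩
    rcases (splitDim_eq_iff C u j).1 hu with ⟨h1, h2⟩ | ⟨-, h⟩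
    · left
      refine ⟨?_, (le_div_iff₀ hA).2 h1.le⟩
      rw [div_le_iff₀ hA]
      by_cases hj : j.val = 0
      · have : Finset.Iio j = ∅ := by
          ext k; simp [Fin.lt_def, hj]
        rw [this, Finset.sum_empty]
        exact mul_nonneg u.2.1 hA.le
      · let k : Fin d := ⟨j.val - 1, by omega⟩
        have : Finset.Iio j = Finset.Iic k := by
          ext i
          simp only [Finset.mem_Iio, Finset.mem_Iic, Fin.lt_def, Fin.le_def, k]
          omega
        rw [this]
        exact not_lt.1 (h2 k (by simp only [Fin.lt_def, k]; omega))
    · right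
      have hd := NeZero.pos d
      have hk := h ⟨d - 1, by omega⟩
      have : Finset.Iic (⟨d - 1, by omega⟩ : Fin d) = Finset.univ := by
        ext i
        simp only [Finset.mem_Iic, Fin.le_def, Finset.mem_univ, iff_true]
        omega
      rw [this, not_lt] at hk
      change C.linDim ≤ _ at hk
      exact le_antisymm u.2.2 (by nlinarith)
  rw [unitInterval.volume_apply]
  refine (measure_mono hsub).trans ((measure_union_le _ _).trans ?_)
  rw [Real.volume_Icc, Real.volume_singleton, add_zero, hab]

/-- Averaging a function of the split dimension. -/
theorem lintegral_splitDim_le {C : Box d} (hC : ∀ j, 0 < C.side j) (F : Fin d → ENNReal) :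
    ∫⁻ u : unitInterval, F (splitDim C u) ≤
      ∑ j, F j * ENNReal.ofReal (C.side j / C.linDim) := by
  have hm : Measurable fun u : unitInterval => splitDim C (u : ℝ) :=
    measurable_splitDim_comp measurable_const measurable_subtype_coe
  rw [← lintegral_map (f := F) measurable_from_top hm, lintegral_fintype]
  refine Finset.sum_le_sum fun j _ => mul_le_mul_right ?_ _
  rw [Measure.map_apply hm (measurableSet_singleton j)]
  exact volume_splitDim_eq_le hC j

theorem sum_side_div_linDim {C : Box d} (hC : ∀ j, 0 < C.side j) :
    ∑ j, C.side j / C.linDim = 1 := by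
  rw [← Finset.sum_div]
  exact div_self (Box.linDim_pos hC).ne'

theorem lintegral_children_le {C : Box d} (hC : ∀ j, 0 < C.side j) {s : ℝ} (hs : 0 ≤ s) :
    ∫⁻ u : unitInterval × unitInterval,
      ∑ b : Bool, ENNReal.ofReal ((C.child (splitDim C u.1)
        ((C (splitDim C u.1)).1 + u.2 * C.side (splitDim C u.1)) b).expectedLeaves s) ≤
      ENNReal.ofReal (C.expectedLeaves s +
        (∑ j, C.side j * C.expectedLeavesErase j s) / C.linDim) := by
  have hC' : ∀ j, 0 ≤ C.side j := fun j => (hC j).le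
  have hE : 0 ≤ C.expectedLeaves s := zero_le_one.trans (Box.one_le_expectedLeaves hC' hs)
  have hQ : ∀ j, 0 ≤ C.expectedLeavesErase j s := fun j =>
    Box.expectedLeavesErase_nonneg hC' j hs
  have hpt : ∀ u : unitInterval × unitInterval,
      ∑ b : Bool, ENNReal.ofReal ((C.child (splitDim C u.1)
        ((C (splitDim C u.1)).1 + u.2 * C.side (splitDim C u.1)) b).expectedLeaves s) =
      ENNReal.ofReal (C.expectedLeaves s + C.expectedLeavesErase (splitDim C u.1) s) := by
    intro u
    have h : ∀ b, 0 ≤ (C.child (splitDim C u.1)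
        ((C (splitDim C u.1)).1 + u.2 * C.side (splitDim C u.1)) b).expectedLeaves s := fun b =>
      zero_le_one.trans (Box.one_le_expectedLeaves (Box.side_child_nonneg hC' _ u.2.2 b) hs)
    rw [Fintype.sum_bool, add_comm, ← ENNReal.ofReal_add (h _) (h _),
      Box.expectedLeaves_child_add]
  simp only [hpt]
  -- The integrand no longer depends on the threshold variable, so only the split dimension is
  -- averaged.
  refine (lintegral_prod_le _).trans ?_
  simp only [lintegral_const, measure_univ, mul_one]
  refine (lintegral_splitDim_le hC fun j =>
    ENNReal.ofReal (C.expectedLeaves s + C.expectedLeavesErase j s)).trans (le_of_eq ?_)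
  have hA := Box.linDim_pos hC
  simp only [← ENNReal.ofReal_mul (add_nonneg hE (hQ _))]
  rw [← ENNReal.ofReal_sum_of_nonneg fun j _ =>
    mul_nonneg (add_nonneg hE (hQ j)) (div_nonneg (hC' j) hA.le)]
  congr 1
  simp only [add_mul, Finset.sum_add_distrib, ← Finset.mul_sum, sum_side_div_linDim hC, mul_one,
    Finset.sum_div]
  congr 1
  exact Finset.sum_congr rfl fun j _ => by ring

theorem ae_expMeasure_nonneg : ∀ᵐ e ∂(expMeasure 1), 0 ≤ e := by
  rw [ae_iff]
  simp only [not_le]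
  change (volume.withDensity (exponentialPDF 1)) (Set.Iio 0) = 0
  rw [withDensity_apply _ measurableSet_Iio]
  exact lintegral_exponentialPDF_of_nonpos le_rfl

/-- The renewal equation behind the expected number of leaves: the first split happens at time
`e / A`, with `e` a standard exponential. -/
theorem lintegral_exp_renewal_le {A s : ℝ} (hA : 0 < A) (hs : 0 ≤ s) {G G' : ℝ → ℝ}
    (hG : ∀ t, HasDerivAt G (G' t) t) (hG' : Continuous G') (hG0 : G 0 = 1)
    (hpos : ∀ t, 0 ≤ t → 0 ≤ G t + G' t / A) :
    ∫⁻ e, ((if s < e / A then 1 else 0) +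
      (if e / A ≤ s then ENNReal.ofReal (G (s - e / A) + G' (s - e / A) / A) else 0))
        ∂(expMeasure 1) ≤ ENNReal.ofReal (G s) := by
  have hGc : Continuous G := continuous_iff_continuousAt.2 fun t => (hG t).continuousAt
  set k : ℝ → ℝ := fun e => Real.exp (-e) * (G (s - e / A) + G' (s - e / A) / A) with hk
  have hkc : Continuous k := by fun_prop
  have hAs : 0 ≤ A * s := mul_nonneg hA.le hs
  have hpdf : Measurable (exponentialPDF 1) :=
    (measurable_exponentialPDFReal 1).ennreal_ofReal
  have hfm : Measurable fun e : ℝ => ((if s < e / A then 1 else 0) +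
      (if e / A ≤ s then ENNReal.ofReal (G (s - e / A) + G' (s - e / A) / A) else 0) :
        ENNReal) := by
    have h1 : Measurable fun e : ℝ => e / A := measurable_id.div_const A
    refine (Measurable.ite (measurableSet_lt measurable_const h1) measurable_const
      measurable_const).add (Measurable.ite (measurableSet_le h1 measurable_const)
        (Continuous.measurable ?_).ennreal_ofReal measurable_const)
    fun_prop
  change ∫⁻ e, _ ∂(volume.withDensity (exponentialPDF 1)) ≤ _
  rw [lintegral_withDensity_eq_lintegral_mul _ hpdf hfm]
  have hle : ∀ e : ℝ, (exponentialPDF 1 * fun e : ℝ => ((if s < e / A then 1 else 0) +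
      (if e / A ≤ s then ENNReal.ofReal (G (s - e / A) + G' (s - e / A) / A) else 0) :
        ENNReal)) e ≤
      (Set.Ioi (A * s)).indicator (fun e => ENNReal.ofReal (Real.exp (-e))) e +
      (Set.Icc 0 (A * s)).indicator (fun e => ENNReal.ofReal (k e)) e := by
    intro e
    rw [Pi.mul_apply]
    rcases lt_or_ge e 0 with he | he
    · rw [exponentialPDF_of_neg he, zero_mul]
      exact zero_le
    · rw [exponentialPDF_of_nonneg he]
      rcases lt_or_ge (A * s) e with h | h
      · have h1 : s < e / A := (lt_div_iff₀' hA).2 h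
        rw [if_pos h1, if_neg (not_le.2 h1), Set.indicator_of_mem (s := Set.Ioi (A * s)) h]
        simp
      · have h1 : e / A ≤ s := (div_le_iff₀' hA).2 h
        rw [if_neg (not_lt.2 h1), if_pos h1, Set.indicator_of_mem (s := Set.Icc 0 (A * s)) ⟨he, h⟩, zero_add,
          ← ENNReal.ofReal_mul (by positivity)]
        simp [hk]
  refine (lintegral_mono hle).trans ?_
  rw [lintegral_add_left ((by fun_prop : Measurable fun e : ℝ =>
      ENNReal.ofReal (Real.exp (-e))).indicator measurableSet_Ioi),
    lintegral_indicator measurableSet_Ioi, lintegral_indicator measurableSet_Icc,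
    ← ofReal_integral_eq_lintegral_ofReal (integrableOn_exp_neg_Ioi _)
      (Filter.Eventually.of_forall fun e => (Real.exp_pos _).le), integral_exp_neg_Ioi,
    ← ofReal_integral_eq_lintegral_ofReal hkc.continuousOn.integrableOn_Icc
      ((ae_restrict_mem measurableSet_Icc).mono fun e he => mul_nonneg (Real.exp_pos _).le
        (hpos _ (sub_nonneg.2 ((div_le_iff₀' hA).2 he.2)))),
    integral_Icc_eq_integral_Ioc, ← intervalIntegral.integral_of_le hAs]
  -- The term `G' / A` is exactly what makes the integrand a derivative.
  have hF : ∀ e ∈ Set.uIcc 0 (A * s),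
      HasDerivAt (fun e => -(Real.exp (-e) * G (s - e / A))) (k e) e := by
    intro e _
    have h1 : HasDerivAt (fun e : ℝ => Real.exp (-e)) (-Real.exp (-e)) e := by
      simpa using (hasDerivAt_neg e).exp
    have h2 : HasDerivAt (fun e : ℝ => s - e / A) (-(1 / A)) e :=
      ((hasDerivAt_id e).div_const A).const_sub s
    have h3 := (h1.mul ((hG (s - e / A)).comp e h2)).neg
    refine h3.congr_deriv ?_
    simp only [hk, Function.comp_apply]
    ring
  rw [intervalIntegral.integral_eq_sub_of_hasDerivAt hF (hkc.intervalIntegrable _ _)]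
  have hGs : 0 ≤ -(Real.exp (-(A * s)) * G (s - A * s / A)) -
      -(Real.exp (-0) * G (s - 0 / A)) := by
    rw [← intervalIntegral.integral_eq_sub_of_hasDerivAt hF (hkc.intervalIntegrable _ _)]
    exact intervalIntegral.integral_nonneg hAs fun e he => mul_nonneg (Real.exp_pos _).le
        (hpos _ (sub_nonneg.2 ((div_le_iff₀' hA).2 he.2)))
  rw [← ENNReal.ofReal_add (Real.exp_pos _).le hGs, mul_div_cancel_left₀ _ hA.ne']
  -- The no-split probability `exp (-A s)` cancels the boundary term `exp (-A s) * G 0`, leaving `G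
  -- s`.
  refine ENNReal.ofReal_le_ofReal (le_of_eq ?_)
  simp [hG0]

/-- One sampling step does not increase the expected number of leaves: either the node is not
split before time `lam`, or its children have their own expected numbers of leaves. -/
theorem lintegral_nodeStep_le {C : Box d} (hC : ∀ j, 0 < C.side j) (τ lam : ℝ) :
    ∫⁻ ω, ((if τ ≤ lam ∧ lam < (nodeStep C τ ω).2.2 then 1 else 0) +
      ∑ b : Bool, if (nodeStep C τ ω).2.2 ≤ lam then
        ENNReal.ofReal ((C.child (nodeStep C τ ω).1 (nodeStep C τ ω).2.1 b).expectedLeaves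
          (lam - (nodeStep C τ ω).2.2)) else 0) ∂seedLaw ≤
      if τ ≤ lam then ENNReal.ofReal (C.expectedLeaves (lam - τ)) else 0 := by
  have hA := Box.linDim_pos hC
  have hC' : ∀ j, 0 ≤ C.side j := fun j => (hC j).le
  have hprob : IsProbabilityMeasure (expMeasure 1) := isProbabilityMeasure_expMeasure one_pos
  refine (lintegral_prod_le _).trans ?_
  split_ifs with hτ
  · refine le_trans (lintegral_mono fun e => ?_) (lintegral_exp_renewal_le hA (sub_nonneg.2 hτ)
      C.hasDerivAt_expectedLeaves ?_ ?_ ?_)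
    · simp only [nodeStep, hτ, true_and]
      rcases lt_or_ge (lam - τ) (e / C.linDim) with h | h
      · rw [if_pos h, if_neg (not_le.2 h)]
        have h1 : lam < τ + e / C.linDim := by linarith
        simp [h1, not_le.2 h1]
      · rw [if_neg (not_lt.2 h), if_pos h]
        have h1 : τ + e / C.linDim ≤ lam := by linarith
        simp only [h1, not_lt.2 h1, if_true, if_false, zero_add]
        rw [← sub_sub]
        exact lintegral_children_le hC (sub_nonneg.2 h)
    · exact continuous_finsetSum _ fun j _ =>
        continuous_const.mul (C.continuous_expectedLeavesErase j)
    · simp [Box.expectedLeaves]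
    · intro t ht
      exact add_nonneg (zero_le_one.trans (Box.one_le_expectedLeaves hC' ht))
        (div_nonneg (Finset.sum_nonneg fun j _ => mul_nonneg (hC' j)
          (Box.expectedLeavesErase_nonneg hC' j ht)) hA.le)
  · refine le_of_eq ?_
    rw [lintegral_eq_zero_of_ae_eq_zero]
    filter_upwards [ae_expMeasure_nonneg] with e he
    have h1 : ¬ τ + e / C.linDim ≤ lam := by
      have := div_nonneg he hA.le
      linarith [not_le.1 hτ]
    simp [nodeStep, hτ, h1]

end OneStep

/-! ### The expected number of leaves of a time pruning -/

section ExpectedLeaves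

variable {d : ℕ} [NeZero d]

theorem birth_sampleMondrian (ω : Word → Seed) (v : Word) :
    birth (sampleMondrian (d := d) ω) v = (sampleState d ω v).2 := by
  cases v <;> rfl

theorem sampleState_congr {ω ω' : Word → Seed} {v : Word}
    (h : ∀ w : Word, w.length < v.length → w <:+ v → ω w = ω' w) :
    sampleState d ω v = sampleState d ω' v := by
  induction v with
  | nil => rfl
  | cons b v ih =>
    simp only [sampleState]
    rw [ih fun w hw hs => h w (by simp only [List.length_cons]; omega)
      (hs.trans (List.suffix_cons b v)), h v (by simp) (List.suffix_cons b v)]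

theorem side_sampleState_nonneg (ω : Word → Seed) (v : Word) (j : Fin d) :
    0 ≤ (sampleState d ω v).1.side j := by
  induction v generalizing j with
  | nil => simp [sampleState, Box.side]
  | cons b v ih => exact Box.side_child_nonneg ih _ (ω v).2.2.2 b j

/-- Thresholds off the endpoints keep every linear dimension positive, so that the divisions by it
are genuine. -/
theorem side_sampleState_pos {ω : Word → Seed}
    (hω : ∀ v, ((ω v).2.2 : ℝ) ∈ Set.Ioo (0 : ℝ) 1) (v : Word) (j : Fin d) :
    0 < (sampleState d ω v).1.side j := by
  induction v generalizing j with
  | nil => simp [sampleState, Box.side]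
  | cons b v ih => exact Box.side_child_pos ih _ (hω v) b j

theorem ae_seedLaw : ∀ᵐ s ∂seedLaw, 0 ≤ s.1 ∧ (s.2.2 : ℝ) ∈ Set.Ioo (0 : ℝ) 1 := by
  have hprob : IsProbabilityMeasure (expMeasure 1) := isProbabilityMeasure_expMeasure one_pos
  have h1 : ∀ᵐ s ∂seedLaw, 0 ≤ s.1 :=
    (Measure.quasiMeasurePreserving_fst (μ := expMeasure 1)
      (ν := (volume : Measure (unitInterval × unitInterval)))).ae ae_expMeasure_nonneg
  have hne : ∀ u₀ : unitInterval, ∀ᵐ s ∂seedLaw, s.2.2 ≠ u₀ := fun u₀ =>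
    (Measure.quasiMeasurePreserving_snd (μ := expMeasure 1)
      (ν := (volume : Measure (unitInterval × unitInterval)))).ae
      ((Measure.quasiMeasurePreserving_snd (μ := (volume : Measure unitInterval))
        (ν := (volume : Measure unitInterval))).ae
        (compl_mem_ae_iff.2 (measure_singleton u₀)))
  filter_upwards [h1, hne 0, hne 1] with s hs h0 h1
  exact ⟨hs, unitInterval.pos_iff_ne_zero.2 h0, unitInterval.lt_one_iff_ne_one.2 h1⟩

theorem ae_forall_seed : ∀ᵐ ω ∂(Measure.infinitePi fun _ : Word => seedLaw), ∀ v : Word,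
    0 ≤ (ω v).1 ∧ ((ω v).2.2 : ℝ) ∈ Set.Ioo (0 : ℝ) 1 :=
  ae_all_iff.2 fun v => (measurePreserving_eval_infinitePi
    (fun _ : Word => seedLaw) v).quasiMeasurePreserving.ae ae_seedLaw

/-- The seed at a node is independent of the state of this node. -/
theorem indepFun_sampleState (v : Word) :
    IndepFun (fun ω : Word → Seed => sampleState d ω v) (fun ω => ω v)
      (Measure.infinitePi fun _ : Word => seedLaw) := by
  classical
  set S : Finset Word := v.tails.toFinset.erase v with hS
  have hmem : ∀ w : Word, w.length < v.length → w <:+ v → w ∈ S := fun w hw hs =>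
    Finset.mem_erase.2 ⟨fun h => by simp [h] at hw, by simpa using hs⟩
  have hind := (iIndepFun_infinitePi (P := fun _ : Word => seedLaw)
    (X := fun (_ : Word) (s : Seed) => s) fun _ => measurable_id).indepFun_finset S {v}
      (by simp [hS]) fun i => measurable_pi_apply i
  -- The state of `v` reads only the seeds of strict ancestors (`sampleState_congr`), so the padding
  -- elsewhere is irrelevant.
  let ext : (S → Seed) → Word → Seed := fun r w => if h : w ∈ S then r ⟨w, h⟩ else (0, 0, 0)
  have hext : Measurable ext := measurable_pi_lambda _ fun w => by
    by_cases h : w ∈ S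
    · simpa only [ext, dif_pos h] using measurable_pi_apply _
    · simpa only [ext, dif_neg h] using measurable_const
  have hproj : Measurable fun r : ({v} : Finset Word) → Seed =>
      r ⟨v, Finset.mem_singleton_self v⟩ := measurable_pi_apply _
  have h := hind.comp (φ := fun r => sampleState d (ext r) v)
    (ψ := fun r : ({v} : Finset Word) → Seed => r ⟨v, Finset.mem_singleton_self v⟩)
    ((measurable_sampleState v).comp hext) hproj
  refine h.congr (Filter.Eventually.of_forall fun ω => ?_)
    (Filter.Eventually.of_forall fun ω => rfl)
  refine sampleState_congr fun w hw hs => ?_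
  simp only [ext, dif_pos (hmem w hw hs)]

theorem lintegral_sampleState_seed (v : Word) {f : (Box d × ℝ) × Seed → ENNReal}
    (hf : Measurable f) :
    ∫⁻ ω, f (sampleState d ω v, ω v) ∂(Measure.infinitePi fun _ : Word => seedLaw) =
      ∫⁻ ω, ∫⁻ s, f (sampleState d ω v, s) ∂seedLaw
        ∂(Measure.infinitePi fun _ : Word => seedLaw) := by
  have hS := measurable_sampleState (d := d) v
  have hv : Measurable fun ω : Word → Seed => ω v := measurable_pi_apply v
  have h := (indepFun_iff_map_prod_eq_prod_map_map hS.aemeasurable hv.aemeasurable).1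
    (indepFun_sampleState (d := d) v)
  rw [← lintegral_map hf (hS.prodMk hv), h, Measure.infinitePi_map_eval,
    lintegral_prod _ hf.aemeasurable, lintegral_map hf.lintegral_prod_right' hS]

/-- Induction from the children to `v`: the hypothesis bounds the mean counts below the children,
and averaging over the fresh seed at `v`, independent of its state, reduces the step to
`lintegral_nodeStep_le`. The indicator discards nodes born after `lam`. -/
theorem lintegral_truncCount_aux (lam : ℝ) (k : ℕ) (v : Word) :
    ∫⁻ ω, (if (sampleState d ω v).2 ≤ lam then
        (truncCount (sampleMondrian (d := d) ω) lam k v : ENNReal) else 0)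
        ∂(Measure.infinitePi fun _ : Word => seedLaw) ≤
      ∫⁻ ω, (if (sampleState d ω v).2 ≤ lam then
        ENNReal.ofReal ((sampleState d ω v).1.expectedLeaves (lam - (sampleState d ω v).2)) else 0)
        ∂(Measure.infinitePi fun _ : Word => seedLaw) := by
  induction k generalizing v with
  | zero =>
    refine lintegral_mono fun ω => ?_
    simp only
    split_ifs with h
    · simpa [truncCount] using Box.one_le_expectedLeaves (side_sampleState_nonneg ω v)
        (sub_nonneg.2 h)
    · exact le_rfl
  | succ k ih =>
    have hst := fun v : Word => measurable_sampleState (d := d) v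
    have hpt : ∀ ω : Word → Seed, (if (sampleState d ω v).2 ≤ lam then
        (truncCount (sampleMondrian (d := d) ω) lam (k + 1) v : ENNReal) else 0) ≤
        (if (sampleState d ω v).2 ≤ lam ∧ lam < (sampleMondrian (d := d) ω v).2.2 then 1 else 0) +
        ∑ b : Bool, if (sampleState d ω (b :: v)).2 ≤ lam then
          (truncCount (sampleMondrian (d := d) ω) lam k (b :: v) : ENNReal) else 0 := by
      intro ω
      have hb : ∀ b, (sampleState d ω (b :: v)).2 = (sampleMondrian (d := d) ω v).2.2 :=
        fun _ => rfl
      simp only [hb, truncCount, Fintype.sum_bool]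
      by_cases h1 : (sampleState d ω v).2 ≤ lam <;>
        by_cases h2 : (sampleMondrian (d := d) ω v).2.2 ≤ lam <;>
        simp [h1, h2, not_lt.2, not_le.1, add_comm]
    refine (lintegral_mono hpt).trans ?_
    have hm1 : Measurable fun ω : Word → Seed => (if (sampleState d ω v).2 ≤ lam ∧
        lam < (sampleMondrian (d := d) ω v).2.2 then 1 else 0 : ENNReal) := by
      refine Measurable.ite ?_ measurable_const measurable_const
      exact (measurableSet_le (hst v).snd measurable_const).inter (measurableSet_lt measurable_const
        ((measurable_splitTime v).comp measurable_sampleMondrian))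
    have hm2 : ∀ b : Bool, Measurable fun ω : Word → Seed =>
        (if (sampleState d ω (b :: v)).2 ≤ lam then
          (truncCount (sampleMondrian (d := d) ω) lam k (b :: v) : ENNReal) else 0) := fun b => by
      refine Measurable.ite (measurableSet_le (hst _).snd measurable_const) ?_ measurable_const
      exact (measurable_from_top (f := fun m : ℕ => (m : ENNReal))).comp
        ((measurable_truncCount lam k _).comp measurable_sampleMondrian)
    have hm3 : ∀ b : Bool, Measurable fun ω : Word → Seed =>
        (if (sampleState d ω (b :: v)).2 ≤ lam then
          ENNReal.ofReal ((sampleState d ω (b :: v)).1.expectedLeaves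
            (lam - (sampleState d ω (b :: v)).2)) else 0) := fun b =>
      Measurable.ite (measurableSet_le (hst _).snd measurable_const)
        (measurable_expectedLeaves (hst _).fst ((hst _).snd.const_sub lam)).ennreal_ofReal
        measurable_const
    rw [lintegral_add_left hm1, lintegral_finsetSum _ fun b _ => hm2 b]
    refine (add_le_add_right (Finset.sum_le_sum fun b _ => ih (b :: v)) _).trans ?_
    rw [← lintegral_finsetSum _ fun b _ => hm3 b, ← lintegral_add_left hm1]
    have hf : Measurable fun p : (Box d × ℝ) × Seed =>
        ((if p.1.2 ≤ lam ∧ lam < (nodeStep p.1.1 p.1.2 p.2).2.2 then 1 else 0) +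
        ∑ b : Bool, if (nodeStep p.1.1 p.1.2 p.2).2.2 ≤ lam then
          ENNReal.ofReal ((p.1.1.child (nodeStep p.1.1 p.1.2 p.2).1
            (nodeStep p.1.1 p.1.2 p.2).2.1 b).expectedLeaves
            (lam - (nodeStep p.1.1 p.1.2 p.2).2.2)) else 0 : ENNReal) := by
      have hr : Measurable fun p : (Box d × ℝ) × Seed => nodeStep p.1.1 p.1.2 p.2 :=
        measurable_nodeStep measurable_fst.fst measurable_fst.snd measurable_snd
      refine Measurable.add (Measurable.ite ?_ measurable_const measurable_const)
        (Finset.measurable_sum _ fun b _ => Measurable.ite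
          (measurableSet_le hr.snd.snd measurable_const) ?_ measurable_const)
      · exact (measurableSet_le measurable_fst.snd measurable_const).inter
          (measurableSet_lt measurable_const hr.snd.snd)
      · exact (measurable_expectedLeaves (measurable_child measurable_fst.fst hr.fst hr.snd.fst b)
          (hr.snd.snd.const_sub lam)).ennreal_ofReal
    refine (lintegral_sampleState_seed v hf).trans_le (lintegral_mono_ae ?_)
    filter_upwards [ae_forall_seed] with ω hω
    exact lintegral_nodeStep_le (side_sampleState_pos (fun w => (hω w).2) v) _ lam

theorem lintegral_truncCount_le {lam : ℝ} (hlam : 0 ≤ lam) (k : ℕ) :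
    ∫⁻ P, (truncCount P lam k [] : ENNReal) ∂(mondrianProcess d) ≤
      ENNReal.ofReal ((1 + lam) ^ d) := by
  have hm : Measurable fun P : InfTree d => (truncCount P lam k [] : ENNReal) :=
    (measurable_from_top (f := fun m : ℕ => (m : ENNReal))).comp (measurable_truncCount lam k _)
  rw [mondrianProcess, lintegral_map hm measurable_sampleMondrian]
  have h := lintegral_truncCount_aux (d := d) lam k []
  simpa [sampleState, hlam, Box.expectedLeaves, Box.side] using h

theorem ae_birth_le : ∀ᵐ P ∂(mondrianProcess d), ∀ v, birth P v ≤ (P v).2.2 := by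
  have hms : MeasurableSet {P : InfTree d | ∀ v, birth P v ≤ (P v).2.2} := by
    rw [Set.ofPred_forall]
    exact MeasurableSet.iInter fun v => measurableSet_le (measurable_birth v)
      (measurable_splitTime v)
  rw [mondrianProcess, ae_map_iff measurable_sampleMondrian.aemeasurable hms]
  filter_upwards [ae_forall_seed] with ω hω v
  rw [birth_sampleMondrian]
  exact le_add_of_nonneg_right (div_nonneg (hω v).1
    (Box.linDim_pos (side_sampleState_pos (fun w => (hω w).2) v)).le)

/-- The expected number of leaves of a time pruning, as the limit of the truncated counts. -/
theorem lintegral_iSup_truncCount_le {lam : ℝ} (hlam : 0 ≤ lam) :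
    ∫⁻ P, ⨆ k, (truncCount P lam k [] : ENNReal) ∂(mondrianProcess d) ≤
      ENNReal.ofReal ((1 + lam) ^ d) := by
  have hm : ∀ k, Measurable fun P : InfTree d => (truncCount P lam k [] : ENNReal) := fun k =>
    (measurable_from_top (f := fun m : ℕ => (m : ENNReal))).comp (measurable_truncCount lam k _)
  rw [lintegral_iSup hm fun i j hij P => Nat.cast_le.2 (monotone_truncCount [] hij)]
  exact iSup_le fun k => lintegral_truncCount_le hlam k

/-- Almost surely the time pruning is finite. -/
theorem ae_exists_fits {lam : ℝ} (hlam : 0 ≤ lam) :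
    ∀ᵐ P ∂(mondrianProcess d), ∃ T : Pruning, T.Fits P lam [] := by
  have hfin := ae_lt_top' (μ := mondrianProcess d)
    (Measurable.iSup fun k => (measurable_from_top (f := fun m : ℕ => (m : ENNReal))).comp
      (measurable_truncCount lam k [])).aemeasurable
    ((lintegral_iSup_truncCount_le (d := d) hlam).trans_lt ENNReal.ofReal_lt_top).ne
  filter_upwards [hfin] with P hP
  by_contra h
  -- Without a finite fit the truncated counts exceed every `k`, so their supremum would be
  -- infinite.
  refine hP.ne (ENNReal.eq_top_of_forall_nnreal_le fun r => ?_)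
  obtain ⟨k, hk⟩ := exists_nat_ge r
  refine le_trans ?_ (le_iSup _ k)
  calc (r : ENNReal) ≤ (k : ENNReal) := by exact_mod_cast hk
    _ ≤ _ := Nat.cast_le.2 (lt_truncCount (not_exists.1 h) k).le

end ExpectedLeaves

/-! ### Passage to expectations -/

/-- Discarding the negative part moves the regret into `ENNReal`, where the leaf count can be
averaged without a separate integrability proof. -/
theorem integral_le_toReal_lintegral_ofReal {α : Type*} [MeasurableSpace α] {μ : Measure α}
    {f : α → ℝ} (hf : Integrable f μ) : ∫ a, f a ∂μ ≤ (∫⁻ a, ENNReal.ofReal (f a) ∂μ).toReal := by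
  rw [integral_eq_lintegral_pos_part_sub_lintegral_neg_part hf]
  exact sub_le_self _ ENNReal.toReal_nonneg

end

theorem corollary3 {d : ℕ} [NeZero d] (B : ℝ) (hB : 0 < B) (lam : ℝ) (hlam : 0 < lam)
    (n : ℕ) (hn : 2 ≤ n) (x : ℕ → Cube d) (y : ℕ → ℝ)
    (hy : ∀ t < n, y t ∈ Set.Icc (-B) B) :
    Integrable (fun P : InfTree d =>
      ∑ t ∈ Finset.range n, (amf (1 / (8 * B ^ 2)) P x y t (x t) - y t) ^ 2)
        (mondrianProcess d) ∧
    Integrable (fun P : InfTree d =>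
      ⨅ g : {g : Cube d → ℝ // ConstOnCells P lam g},
        ∑ t ∈ Finset.range n, (g.1 (x t) - y t) ^ 2) (mondrianProcess d) ∧
    ∫ P, ∑ t ∈ Finset.range n, (amf (1 / (8 * B ^ 2)) P x y t (x t) - y t) ^ 2
        ∂(mondrianProcess d) ≤
      (∫ P, ⨅ g : {g : Cube d → ℝ // ConstOnCells P lam g},
        ∑ t ∈ Finset.range n, (g.1 (x t) - y t) ^ 2 ∂(mondrianProcess d)) +
      8 * B ^ 2 * (1 + lam) ^ d * Real.log n := by
  have hη : 0 ≤ 1 / (8 * B ^ 2) := by positivity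
  have hc : 0 ≤ 8 * B ^ 2 * Real.log n :=
    mul_nonneg (by positivity) (Real.log_natCast_nonneg n)
  have hint : Integrable (fun P : InfTree d =>
      ∑ t ∈ Finset.range n, (amf (1 / (8 * B ^ 2)) P x y t (x t) - y t) ^ 2)
        (mondrianProcess d) := by
    refine Integrable.of_bound (C := B ^ 2 * (4 * n - 3)) (Measurable.aestronglyMeasurable ?_)
      (Filter.Eventually.of_forall fun P => ?_)
    · exact Finset.measurable_sum _ fun t _ =>
        ((measurable_amf hη x y t (x t)).sub_const _).pow_const 2
    · rw [Real.norm_of_nonneg (Finset.sum_nonneg fun _ _ => sq_nonneg _)]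
      exact sum_amf_loss_le_trivial hη hB.le (by omega) hy
  have hbirth := ae_birth_le (d := d)
  have hfits := ae_exists_fits (d := d) hlam.le
  have hnonneg : ∀ P : InfTree d, 0 ≤ ⨅ g : {g : Cube d → ℝ // ConstOnCells P lam g},
      ∑ t ∈ Finset.range n, (g.1 (x t) - y t) ^ 2 := fun P =>
    Real.iInf_nonneg fun g => Finset.sum_nonneg fun _ _ => sq_nonneg _
  have hint' : Integrable (fun P : InfTree d =>
      ⨅ g : {g : Cube d → ℝ // ConstOnCells P lam g},
        ∑ t ∈ Finset.range n, (g.1 (x t) - y t) ^ 2) (mondrianProcess d) := by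
    -- The zero function is always admissible, and its loss does not depend on the tree.
    refine Integrable.of_bound (C := ∑ t ∈ Finset.range n, (0 - y t) ^ 2)
      (aemeasurable_iInf hlam.le hbirth hfits x y n).aestronglyMeasurable
      (Filter.Eventually.of_forall fun P => ?_)
    rw [Real.norm_of_nonneg (hnonneg P)]
    exact ciInf_le ⟨0, by rintro _ ⟨g, rfl⟩; exact Finset.sum_nonneg fun _ _ => sq_nonneg _⟩
      (⟨fun _ => 0, fun _ _ _ _ _ _ => rfl⟩ : {g : Cube d → ℝ // ConstOnCells P lam g})
  refine ⟨hint, hint', ?_⟩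
  rw [← sub_le_iff_le_add', ← integral_sub hint hint']
  have hbound : 0 ≤ 8 * B ^ 2 * (1 + lam) ^ d * Real.log n := by
    have := mul_nonneg hc (show (0 : ℝ) ≤ (1 + lam) ^ d by positivity)
    linarith
  refine (integral_le_toReal_lintegral_ofReal (hint.sub hint')).trans ?_
  refine ENNReal.toReal_le_of_le_ofReal hbound ?_
  calc ∫⁻ P, ENNReal.ofReal (∑ t ∈ Finset.range n,
          (amf (1 / (8 * B ^ 2)) P x y t (x t) - y t) ^ 2 -
          ⨅ g : {g : Cube d → ℝ // ConstOnCells P lam g},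
            ∑ t ∈ Finset.range n, (g.1 (x t) - y t) ^ 2) ∂(mondrianProcess d)
      ≤ ∫⁻ P, ENNReal.ofReal (8 * B ^ 2 * Real.log n) * ⨆ k, (truncCount P lam k [] : ENNReal)
          ∂(mondrianProcess d) := by
        refine lintegral_mono_ae ?_
        filter_upwards [hbirth, hfits] with P hP hT
        obtain ⟨T, hT⟩ := hT
        have h := hT.regret_le (x := x) hB hlam.le hP hn hy
        refine (ENNReal.ofReal_le_ofReal (sub_le_iff_le_add'.2 h)).trans ?_
        rw [ENNReal.ofReal_mul hc, ENNReal.ofReal_natCast]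
        refine mul_le_mul_right ?_ _
        -- The supremum over `k` is measurable in `P` and dominates the leaf count of whichever `T`
        -- fits, so no measurable choice of `T` is required.
        exact le_trans (Nat.cast_le.2 (hT.leafCount_le le_rfl)) 
          (le_iSup (fun k => (truncCount P lam k [] : ENNReal)) T.size)
    _ ≤ ENNReal.ofReal (8 * B ^ 2 * Real.log n) * ENNReal.ofReal ((1 + lam) ^ d) := by
        rw [lintegral_const_mul' _ _ ENNReal.ofReal_ne_top]
        exact mul_le_mul_right (lintegral_iSup_truncCount_le hlam.le) _
    _ = ENNReal.ofReal (8 * B ^ 2 * (1 + lam) ^ d * Real.log n) := by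
        rw [← ENNReal.ofReal_mul hc]
        congr 1
        ring
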